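/- Let $X$ be a finite alphabet with at least two letters, and let $X^\omega$ be the set of infinite words $x_0x_1x_2\ldots$ over $X$. An automaton over $X$ consists of a set $S$ of states, a transition function $S\times X\to S$, $(s,x)\mapsto s|_x$, and an output function $\pi:S\times X\to X$ such that every $\pi(s,\cdot)$ is a permutation of $X$; each state acts on $X^\omega$ by $s(x_0x_1x_2\ldots)=\pi(s,x_0)\,s|_{x_0}(x_1x_2\ldots)$, and automata are assumed minimized, i.e. different states act differently. The automaton is represented by the directed graph with vertex set $S$ and one arrow $s\to s|_x$ for every $s\in S$, $x\in X$; a cycle is a simple directed cycle of this graph (a set of arrows), and it is trivial if it is a loop at the state acting trivially on $X^\omega$. A finite automaton is polynomial if different nontrivial cycles have no state in common, and it has degree at most $m$ if no directed path meets more than $m+1$ nontrivial cycles. For an integer $m\ge -1$ let $\mathrm{Pol}(m)$ be the group of all transformations of $X^\omega$ given by states of finite polynomial automata over $X$ of degree at most $m$. Let $G$ be a finitely generated subgroup of $\mathrm{Pol}(m)$, where $m\geq -1$, and let $s_1,\ldots,s_k$ be generators of $G$. Then the word problem of $G$ (given a word $w$ of length $n$ over the letters $s_1^{\pm1},\ldots,s_k^{\pm1}$,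 decide whether $w$ represents the identity) is solved by a (multi-stack) Turing machine in time at most $T(n)$, where $T$ is subexponential: for every $a>1$ one has $T(n)\le a^n$ for all sufficiently large $n$. If moreover $m\ge 0$, then there is a constant $C>0$ such that $T(n)\le |X|^{C(\log n)^{m+1}}$ for all $n\ge 2$. -/

import Mathlib

/-- An invertible automaton with alphabet `X` and state set `S`: `next s x` is the end of the arrow
that leaves the state `s` and reads the letter `x`, and `out s x` is the letter it writes. -/
structure MealyAutomaton (X S : Type*) where
  next : S → X → S
  out : S → Equiv.Perm X

namespace MealyAutomaton

variable {X S : Type*} (A : MealyAutomaton X S)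

/-- The state `s|_v` for a finite word `v`. -/
def restr (s : S) (v : List X) : S :=
  v.foldl A.next s

/-- The action of the state `s` on the infinite word `w = w₀ w₁ w₂ …`: the `n`-th letter is
written by the state `s|_v` where `v = w₀ … wₙ₋₁`. -/
def act (s : S) (w : ℕ → X) : ℕ → X :=
  fun n => A.out (A.restr s ((List.range n).map w)) (w n)

/-- Different states act differently on infinite words. -/
def IsMinimized : Prop :=
  Function.Injective A.act

/-- The arrows of the directed path that starts at `s` and reads the word `v`; the arrow leaving
`t` and reading `x` is represented by the pair `(t, x)`. -/
def path : S → List X → List (S × X)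
  | _, [] => []
  | s, x :: v => (s, x) :: path (A.next s x) v

/-- `C` is the set of arrows of a simple directed cycle. -/
def IsCycle (C : Set (S × X)) : Prop :=
  ∃ (s : S) (v : List X), v ≠ [] ∧ A.restr s v = s ∧ ((A.path s v).map Prod.fst).Nodup ∧
    C = {a | a ∈ A.path s v}

/-- `C` is a loop at a state that acts trivially on infinite words. -/
def IsTrivialLoop (C : Set (S × X)) : Prop :=
  ∃ (e : S) (x : X), (∀ w : ℕ → X, A.act e w = w) ∧ A.next e x = e ∧ C = {(e, x)}

/-- A simple directed cycle other than a loop at the trivial state. -/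
def IsNontrivialCycle (C : Set (S × X)) : Prop :=
  A.IsCycle C ∧ ¬ A.IsTrivialLoop C

/-- Different nontrivial cycles have no state in common. -/
def IsPolynomial : Prop :=
  ∀ C D : Set (S × X), A.IsNontrivialCycle C → A.IsNontrivialCycle D → C ≠ D →
    Disjoint (Prod.fst '' C) (Prod.fst '' D)

/-- The nontrivial cycles met by the directed path that starts at `s` and reads `v`. -/
def cyclesAlong (s : S) (v : List X) : Set (Set (S × X)) :=
  {C | A.IsNontrivialCycle C ∧ ∃ u : List X, u <+: v ∧ A.restr s u ∈ Prod.fst '' C}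

/-- No directed path connects more than `m + 1` nontrivial cycles. -/
def DegreeLE (m : ℤ) : Prop :=
  ∀ (s : S) (v : List X), ((A.cyclesAlong s v).ncard : ℤ) ≤ m + 1

end MealyAutomaton

/-- `Pol X m`: the transformations of the space of infinite words over `X` that are given by the
states of finite (minimized) polynomial automata of degree at most `m`. -/
def Pol (X : Type*) (m : ℤ) : Set (Equiv.Perm (ℕ → X)) :=
  {g | ∃ (S : Type) (_ : Finite S) (A : MealyAutomaton X S) (s : S),
    A.IsMinimized ∧ A.IsPolynomial ∧ A.DegreeLE m ∧ A.act s = g}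

/-- The element represented by a word in the letters `s i = (i, true)` and
`(s i)⁻¹ = (i, false)`. -/
def wordValue {G : Type*} [Group G] {k : ℕ} (s : Fin k → G) (w : List (Fin k × Bool)) : G :=
  (w.map fun a => if a.2 then s a.1 else (s a.1)⁻¹).prod

open Classical in
/-- The word problem with respect to the elements `s i`: does a word represent the identity? -/
noncomputable def wordProblem {G : Type*} [Group G] {k : ℕ} (s : Fin k → G)
    (w : List (Fin k × Bool)) : Bool :=
  decide (wordValue s w = 1)

/-- `T` is eventually below every exponential function `aⁿ` with `a > 1`. -/
def IsSubexponential (T : ℕ → ℕ) : Prop :=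
  ∀ a : ℝ, 1 < a → ∀ᶠ n in Filter.atTop, (T n : ℝ) ≤ a ^ n

/-! A word of length `n` in the generators is a tuple of `n` states of one finite automaton. It acts
trivially iff it fixes every letter and each of its sections different from itself acts trivially
(`tupleAct_eq_self_iff`). So it suffices to search along moving paths, on which every letter changes
the tuple. If these have length at most `L`, a depth-first search takes time about `n` times an
exponential in `L`, and everything rests on a polylogarithmic bound for `L`.

Replacing letters by words of a suitable length `l` turns all nontrivial cycles into loops
(`isLoopDegree_power_sigma`). The degree of a state is counted as the number of nontrivial cycles on
a path, so it is at most `m + 1`, and `0` for finitary states.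

The bound on moving paths is proved by induction on the degree (`length_lt_of_moving`). After one
letter every state of top degree has lost degree or sits at a loop. A block at a loop loses degree
unless it reads a constant letter, and then it also writes a constant letter. A block of lower
degree between two surviving loop blocks therefore reads a constant letter and becomes stationary
after `L` steps, where `L` is the bound for lower degree. The three blocks then form a single loop
block (`oneLoop_append`). The number of loop blocks halves every `L + 1` steps, so about `log n`
rounds leave one. A moving path makes this one lose degree as well (`low_of_moving`). Each degree
thus costs a factor of order `log n`. -/

namespace MealyAutomaton

/-! ### Sections of tuples of states, and moving paths -/

section Sections

variable {X S : Type*} (A : MealyAutomaton X S)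

/-- The output letter of a tuple of states (the first state of the list acts first). -/
def outs : List S → X → X
  | [], x => x
  | g :: w, x => outs w (A.out g x)

/-- The tuple of the sections of a tuple of states at a letter. -/
def secs : List S → X → List S
  | [], _ => []
  | g :: w, x => A.next g x :: secs w (A.out g x)

/-- The sections of a tuple of states at a finite word. -/
def secsWord (w : List S) (v : List X) : List S :=
  v.foldl A.secs w

/-- The output word of a tuple of states. -/
def outsWord : List S → List X → List X
  | _, [] => []
  | w, x :: v => A.outs w x :: outsWord (A.secs w x) v

/-- Every letter of the word changes the tuple of sections. -/
def Moving : List S → List X → Prop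
  | _, [] => True
  | w, x :: v => A.secs w x ≠ w ∧ Moving (A.secs w x) v

/-- The action of a tuple of states on infinite words. -/
def tupleAct (w : List S) (u : ℕ → X) : ℕ → X :=
  w.foldl (fun u g => A.act g u) u

variable {A}

theorem outs_append (w₁ w₂ : List S) (x : X) :
    A.outs (w₁ ++ w₂) x = A.outs w₂ (A.outs w₁ x) := by
  induction w₁ generalizing x with
  | nil => rfl
  | cons g w ih => exact ih _

theorem secs_append (w₁ w₂ : List S) (x : X) :
    A.secs (w₁ ++ w₂) x = A.secs w₁ x ++ A.secs w₂ (A.outs w₁ x) := by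
  induction w₁ generalizing x with
  | nil => rfl
  | cons g w ih => exact congrArg _ (ih _)

theorem length_secs (w : List S) (x : X) : (A.secs w x).length = w.length := by
  induction w generalizing x with
  | nil => rfl
  | cons g w ih => simp [secs, ih]

theorem outs_injective (w : List S) : Function.Injective (A.outs w) := by
  induction w with
  | nil => exact fun _ _ h => h
  | cons g w ih => exact fun _ _ h => (A.out g).injective (ih h)

@[simp] theorem secsWord_nil (w : List S) : A.secsWord w [] = w := rfl

@[simp] theorem secsWord_cons (w : List S) (x : X) (v : List X) :
    A.secsWord w (x :: v) = A.secsWord (A.secs w x) v := rfl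

theorem secsWord_append_word (w : List S) (v₁ v₂ : List X) :
    A.secsWord w (v₁ ++ v₂) = A.secsWord (A.secsWord w v₁) v₂ :=
  List.foldl_append

theorem secsWord_nil_tuple (v : List X) : A.secsWord [] v = [] := by
  induction v with
  | nil => rfl
  | cons x v ih => exact ih

theorem length_secsWord (w : List S) (v : List X) : (A.secsWord w v).length = w.length := by
  induction v generalizing w with
  | nil => rfl
  | cons x v ih => rw [secsWord_cons, ih, length_secs]

theorem length_outsWord (w : List S) (v : List X) : (A.outsWord w v).length = v.length := by
  induction v generalizing w with
  | nil => rfl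
  | cons x v ih => simp [outsWord, ih]

theorem secsWord_append (w₁ w₂ : List S) (v : List X) :
    A.secsWord (w₁ ++ w₂) v = A.secsWord w₁ v ++ A.secsWord w₂ (A.outsWord w₁ v) := by
  induction v generalizing w₁ w₂ with
  | nil => rfl
  | cons x v ih => rw [secsWord_cons, secs_append, ih]; rfl

theorem outsWord_append (w₁ w₂ : List S) (v : List X) :
    A.outsWord (w₁ ++ w₂) v = A.outsWord w₂ (A.outsWord w₁ v) := by
  induction v generalizing w₁ w₂ with
  | nil => rfl
  | cons x v ih => simp only [outsWord, outs_append, secs_append, ih]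

theorem outsWord_append_word (w : List S) (v₁ v₂ : List X) :
    A.outsWord w (v₁ ++ v₂) = A.outsWord w v₁ ++ A.outsWord (A.secsWord w v₁) v₂ := by
  induction v₁ generalizing w with
  | nil => rfl
  | cons x v ih => simp [outsWord, ih]

theorem Moving.append_iff {w : List S} {v₁ v₂ : List X} :
    A.Moving w (v₁ ++ v₂) ↔ A.Moving w v₁ ∧ A.Moving (A.secsWord w v₁) v₂ := by
  induction v₁ generalizing w with
  | nil => simp [Moving]
  | cons x v ih => simp [Moving, ih, and_assoc]

/-- A tuple that reads a constant letter becomes stationary after as many steps as the longest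
moving path allows. -/
theorem secs_secsWord_replicate {w : List S} {L : ℕ}
    (hL : ∀ v, A.Moving w v → v.length ≤ L) (c : X) :
    A.secs (A.secsWord w (List.replicate L c)) c = A.secsWord w (List.replicate L c) := by
  by_contra h
  -- Once `c` fixes the tuple it fixes it forever. If the tuple were not fixed after `L` letters,
  -- all `L + 1` steps would be moving, contrary to `hL`.
  have key : ∀ i ≤ L + 1, A.Moving w (List.replicate i c) := by
    intro i hi
    by_contra hm
    have hst : ∀ (i : ℕ) (w : List S), ¬ A.Moving w (List.replicate i c) → ∀ j, i ≤ j + 1 →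
        A.secs (A.secsWord w (List.replicate j c)) c = A.secsWord w (List.replicate j c) := by
      intro i
      induction i with
      | zero => intro w hm; simp [Moving] at hm
      | succ i ih =>
        intro w hm j hj
        by_cases hw : A.secs w c = w
        · have : A.secsWord w (List.replicate j c) = w := by
            induction j with
            | zero => rfl
            | succ j ihj =>
              clear hj ihj
              generalize j + 1 = k
              induction k with
              | zero => rfl
              | succ k ihk => rw [List.replicate_succ, secsWord_cons, hw, ihk]
          rw [this, hw]
        · rw [List.replicate_succ] at hm
          have hm' : ¬ A.Moving (A.secs w c) (List.replicate i c) := fun hh => hm ⟨hw, hh⟩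
          rcases j with _ | j
          · have : i = 0 := by omega
            subst this
            exact absurd trivial hm'
          · exact ih _ hm' j (by omega)
    exact h (hst i w hm L hi)
  have := hL _ (key (L + 1) le_rfl)
  simp at this

/-- A tuple that keeps writing a constant letter becomes stationary as well. -/
theorem secs_eq_of_outsWord_eq_replicate {w : List S} {L : ℕ}
    (hL : ∀ v, A.Moving w v → v.length ≤ L) {c x : X} {v : List X} (hv : L ≤ v.length)
    (h : A.outsWord w (v ++ [x]) = List.replicate (v.length + 1) c) :
    A.secs (A.secsWord w v) x = A.secsWord w v := by
  by_contra hne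
  -- If a letter `y` fixes the tuple and writes `c`, injectivity of the output forces all later
  -- letters to be `y`, and the tuple never changes again. So movement at the last letter forces
  -- movement at all earlier ones.
  have key : ∀ (v : List X) (w : List S),
      A.outsWord w (v ++ [x]) = List.replicate (v.length + 1) c →
      A.secs (A.secsWord w v) x ≠ A.secsWord w v → A.Moving w (v ++ [x]) := by
    intro v
    induction v with
    | nil => exact fun w _ h => ⟨h, trivial⟩
    | cons y v ih =>
      intro w h hne
      rw [List.cons_append, outsWord, List.length_cons, List.replicate_succ, List.cons.injEq] at h
      refine ⟨fun hw => ?_, ih _ h.2 hne⟩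
      rw [secsWord_cons, hw] at hne
      rw [hw] at h
      have hall : ∀ v' : List X, A.outsWord w v' = List.replicate v'.length c →
          ∀ z ∈ v', z = y := by
        intro v'
        induction v' with
        | nil => simp
        | cons z v' ih' =>
          intro h'
          rw [outsWord, List.length_cons, List.replicate_succ, List.cons.injEq] at h'
          have hz : z = y := outs_injective w (h'.1.trans h.1.symm)
          subst hz
          rw [hw] at h'
          simpa using ih' h'.2
      have hmem := hall (v ++ [x]) (by simpa using h.2)
      have hv : A.secsWord w v = w := by
        have : ∀ v' : List X, (∀ z ∈ v', z = y) → A.secsWord w v' = w := by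
          intro v'
          induction v' with
          | nil => simp
          | cons z v' ih' =>
            intro hz
            rw [secsWord_cons, hz z (by simp), hw, ih' fun z hz' => hz z (by simp [hz'])]
        exact this v fun z hz => hmem z (by simp [hz])
      rw [hv, hmem x (by simp), hw] at hne
      exact hne rfl
  have := hL _ (key v w h hne)
  simp at this
  omega

end Sections

/-! ### Polylogarithmic length of moving paths -/

section Depth

variable {X S : Type*} (A : MealyAutomaton X S) (deg : S → ℕ)

/-- The degree function `deg` does not increase along the arrows, states of degree `0` become
stationary after one step, and after one step a state of positive degree either has lost degree
or sits at its only loop, all other arrows decreasing the degree. -/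
structure IsLoopDegree : Prop where
  next_le : ∀ g x, deg (A.next g x) ≤ deg g
  next_next : ∀ g x y, deg g = 0 → A.next (A.next g x) y = A.next g x
  exists_loop : ∀ g x, deg (A.next g x) = deg g → 0 < deg g →
    ∃ l, A.next (A.next g x) l = A.next g x ∧
      ∀ y, y ≠ l → deg (A.next (A.next g x) y) < deg g

/-- All states of the tuple have degree at most `d`. -/
def Low (d : ℕ) (w : List S) : Prop := ∀ g ∈ w, deg g ≤ d

/-- The tuple is fixed by one letter and loses degree at all others. -/
def LoopTuple (d : ℕ) (w : List S) : Prop :=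
  ∃ l, A.secs w l = w ∧ ∀ y, y ≠ l → Low deg d (A.secs w y)

/-- At most one block of the tuple has not yet lost degree. -/
def OneLoop (d : ℕ) (w : List S) : Prop :=
  ∃ b u b', w = b ++ (u ++ b') ∧ Low deg d b ∧ (Low deg d u ∨ A.LoopTuple deg d u) ∧ Low deg d b'

/-- The tuple is a concatenation of at most `c` tuples with at most one loop block each. -/
def LoopCountLE (d c : ℕ) (w : List S) : Prop :=
  ∃ ws : List (List S), ws.length ≤ c ∧ w = ws.flatten ∧ ∀ u ∈ ws, A.OneLoop deg d u

variable {A deg} {d : ℕ}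

theorem Low.append {w₁ w₂ : List S} (h₁ : Low deg d w₁) (h₂ : Low deg d w₂) :
    Low deg d (w₁ ++ w₂) := by
  intro g hg
  rcases List.mem_append.1 hg with h | h
  exacts [h₁ g h, h₂ g h]

theorem Low.nil : Low deg d ([] : List S) := by simp [Low]

theorem Low.oneLoop {w : List S} (h : Low deg d w) : A.OneLoop deg d w :=
  ⟨w, [], [], by simp, h, Or.inl Low.nil, Low.nil⟩

namespace IsLoopDegree

variable (hA : A.IsLoopDegree deg)
include hA

theorem low_secs {w : List S} (h : Low deg d w) (x : X) : Low deg d (A.secs w x) := by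
  induction w generalizing x with
  | nil => exact h
  | cons g w ih =>
    intro g' hg'
    rcases List.mem_cons.1 hg' with rfl | hg'
    · exact (hA.next_le g x).trans (h g (by simp))
    · exact ih (fun g hg => h g (by simp [hg])) _ g' hg'

theorem low_secsWord {w : List S} (h : Low deg d w) (v : List X) :
    Low deg d (A.secsWord w v) := by
  induction v generalizing w with
  | nil => exact h
  | cons x v ih => exact ih (hA.low_secs h x)

/-- A loop block either loses degree or reads and writes constant letters. -/
theorem loopTuple_secsWord {u : List S} (h : A.LoopTuple deg d u) (v : List X) :
    Low deg d (A.secsWord u v) ∨ (A.LoopTuple deg d u ∧ A.secsWord u v = u ∧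
      ∃ l c, v = List.replicate v.length l ∧ A.secs u l = u ∧
        (∀ y, y ≠ l → Low deg d (A.secs u y)) ∧
        A.outs u l = c ∧ A.outsWord u v = List.replicate v.length c) := by
  obtain ⟨l, hl, hlow⟩ := id h
  by_cases hv : ∀ x ∈ v, x = l
  · right
    have hv' : v = List.replicate v.length l := List.eq_replicate_of_mem hv
    have h1 : ∀ i, A.secsWord u (List.replicate i l) = u := by
      intro i
      induction i with
      | zero => rfl
      | succ i ih => rw [List.replicate_succ, secsWord_cons, hl, ih]
    have h2 : ∀ i, A.outsWord u (List.replicate i l) = List.replicate i (A.outs u l) := by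
      intro i
      induction i with
      | zero => rfl
      | succ i ih => rw [List.replicate_succ, outsWord, hl, ih, List.replicate_succ]
    refine ⟨h, by rw [hv', h1], l, _, hv', hl, hlow, rfl, ?_⟩
    conv_lhs => rw [hv']
    exact h2 _
  · left
    induction v with
    | nil => simp at hv
    | cons x v ih =>
      by_cases hx : x = l
      · subst hx
        rw [secsWord_cons, hl]
        exact ih fun h' => hv (by simpa using h')
      · exact hA.low_secsWord (hlow x hx) v

theorem oneLoop_secsWord {w : List S} (h : A.OneLoop deg d w) (v : List X) :
    A.OneLoop deg d (A.secsWord w v) := by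
  obtain ⟨b, u, b', rfl, hb, hu, hb'⟩ := h
  rw [secsWord_append, secsWord_append]
  refine ⟨_, _, _, rfl, hA.low_secsWord hb _, ?_, hA.low_secsWord hb' _⟩
  rcases hu with hu | hu
  · exact Or.inl (hA.low_secsWord hu _)
  · rcases hA.loopTuple_secsWord hu (A.outsWord b v) with h | ⟨h, h', _⟩
    · exact Or.inl h
    · rw [h']; exact Or.inr h

/-- Two loop blocks that survive for a long time merge. -/
theorem oneLoop_append {w₁ w₂ : List S} (h₁ : A.OneLoop deg d w₁) (h₂ : A.OneLoop deg d w₂)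
    {n L : ℕ} (hn : (w₁ ++ w₂).length ≤ n)
    (hL : ∀ w v, w.length ≤ n → Low deg d w → A.Moving w v → v.length ≤ L)
    {v : List X} (hv : v.length = L + 1) :
    A.OneLoop deg d (A.secsWord (w₁ ++ w₂) v) := by
  have merge : ∀ {p q : List S}, Low deg d p → A.OneLoop deg d q → A.OneLoop deg d (p ++ q) := by
    rintro p q hp ⟨b, u, b', rfl, hb, hu, hb'⟩
    exact ⟨p ++ b, u, b', by simp, hp.append hb, hu, hb'⟩
  have merge' : ∀ {p q : List S}, A.OneLoop deg d p → Low deg d q → A.OneLoop deg d (p ++ q) := by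
    rintro p q ⟨b, u, b', rfl, hb, hu, hb'⟩ hq
    exact ⟨b, u, b' ++ q, by simp, hb, hu, hb'.append hq⟩
  have key := hA.oneLoop_secsWord h₂ (A.outsWord w₁ v)
  obtain ⟨b₁, u₁, b₁', rfl, hb₁, hu₁, hb₁'⟩ := h₁
  obtain ⟨b₂, u₂, b₂', rfl, hb₂, hu₂, hb₂'⟩ := h₂
  -- If one of the two loop blocks loses degree, the other one is the only one left. The main case
  -- is that both survive.
  have easy₁ : Low deg d (A.secsWord u₁ (A.outsWord b₁ v)) →
      A.OneLoop deg d (A.secsWord (b₁ ++ (u₁ ++ b₁') ++ (b₂ ++ (u₂ ++ b₂'))) v) := by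
    intro h
    rw [secsWord_append]
    refine merge ?_ key
    rw [secsWord_append, secsWord_append]
    exact (hA.low_secsWord hb₁ _).append (h.append (hA.low_secsWord hb₁' _))
  rcases hu₁ with hu₁ | hu₁
  · exact easy₁ (hA.low_secsWord hu₁ _)
  rcases hA.loopTuple_secsWord hu₁ (A.outsWord b₁ v) with h | ⟨-, hs₁, l₁, c₁, hv₁, hl₁, hlow₁, hc₁, ho₁⟩
  · exact easy₁ h
  have easy₂ : Low deg d (A.secsWord u₂ (A.outsWord (b₁ ++ (u₁ ++ (b₁' ++ b₂))) v)) →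
      A.OneLoop deg d (A.secsWord (b₁ ++ (u₁ ++ b₁') ++ (b₂ ++ (u₂ ++ b₂'))) v) := by
    intro h
    have e : b₁ ++ (u₁ ++ b₁') ++ (b₂ ++ (u₂ ++ b₂')) =
        (b₁ ++ (u₁ ++ (b₁' ++ b₂))) ++ (u₂ ++ b₂') := by simp
    rw [e, secsWord_append]
    refine merge' (hA.oneLoop_secsWord ⟨b₁, u₁, _, rfl, hb₁, Or.inr hu₁, hb₁'.append hb₂⟩ v) ?_
    rw [secsWord_append]
    exact h.append (hA.low_secsWord hb₂' _)
  rcases hu₂ with hu₂ | hu₂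
  · exact easy₂ (hA.low_secsWord hu₂ _)
  rcases hA.loopTuple_secsWord hu₂ (A.outsWord (b₁ ++ (u₁ ++ (b₁' ++ b₂))) v) with
    h | ⟨-, hs₂, l₂, c₂, hv₂, hl₂, hlow₂, hc₂, ho₂⟩
  · exact easy₂ h
  set m := b₁' ++ b₂ with hm
  have hlen : (A.outsWord b₁ v).length = L + 1 := by rw [length_outsWord, hv]
  have e : b₁ ++ (u₁ ++ b₁') ++ (b₂ ++ (u₂ ++ b₂')) = b₁ ++ ((u₁ ++ (m ++ u₂)) ++ b₂') := by
    simp [hm]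
  rw [outsWord_append, outsWord_append, ho₁, hlen] at hv₂ hs₂
  rw [length_outsWord, List.length_replicate] at hv₂
  have hmL : ∀ v, A.Moving m v → v.length ≤ L :=
    fun v => hL m v (by rw [e] at hn; simp at hn; omega) (hb₁'.append hb₂)
  -- The surviving block `u₁` feeds the constant letter `c₁` to the middle block `m`, which is
  -- therefore stationary after `L` letters.
  have hstat := secs_secsWord_replicate hmL c₁
  set m' := A.secsWord m (List.replicate L c₁) with hm'
  -- The last letter is read by the stationary `m'`. Since `u₂` survives, what `m'` writes must be
  -- the loop letter of `u₂`.
  have hout : A.outs m' c₁ = l₂ := by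
    rw [List.replicate_succ', outsWord_append_word, ← hm', List.replicate_succ'] at hv₂
    have := (List.append_inj' hv₂ rfl).2
    simpa [outsWord] using this
  have hms : A.secsWord m (List.replicate (L + 1) c₁) = m' := by
    rw [List.replicate_succ', secsWord_append_word, ← hm', secsWord_cons, hstat, secsWord_nil]
  rw [e, secsWord_append, secsWord_append, secsWord_append, secsWord_append]
  refine ⟨_, _, _, rfl, hA.low_secsWord hb₁ _, Or.inr ?_, hA.low_secsWord hb₂' _⟩
  rw [hs₁, ho₁, hlen, hms, hs₂]
  refine ⟨l₁, ?_, fun y hy => ?_⟩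
  · rw [secs_append, secs_append, hl₁, hc₁, hstat, hout, hl₂]
  · rw [secs_append, secs_append]
    refine (hlow₁ y hy).append ((hA.low_secs (hA.low_secsWord (hb₁'.append hb₂) _) _).append ?_)
    -- Outputs are injective, so a letter other than `l₁` reaches `u₂` as a letter other than `l₂`,
    -- and `u₂` loses degree too.
    refine hlow₂ _ fun h => hy ?_
    rw [← hout] at h
    exact outs_injective u₁ ((outs_injective m' h).trans hc₁.symm)

/-- Neighbouring one-loop tuples merge in pairs. The word varies in the induction because the
remaining tuples read what the first two write. -/
theorem loopCountLE_secsWord {n L : ℕ}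
    (hL : ∀ w v, w.length ≤ n → Low deg d w → A.Moving w v → v.length ≤ L)
    {v : List X} (hv : v.length = L + 1) :
    ∀ (c : ℕ) (w : List S), w.length ≤ n → A.LoopCountLE deg d c w →
      A.LoopCountLE deg d ((c + 1) / 2) (A.secsWord w v) := by
  suffices H : ∀ (N : ℕ) (ws : List (List S)) (v : List X), ws.length ≤ N → v.length = L + 1 →
      ws.flatten.length ≤ n →
      (∀ u ∈ ws, A.OneLoop deg d u) →
      A.LoopCountLE deg d ((ws.length + 1) / 2) (A.secsWord ws.flatten v) by
    rintro c w hw ⟨ws, hc, rfl, hws⟩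
    obtain ⟨ws', h1, h2, h3⟩ := H _ ws v le_rfl hv hw hws
    exact ⟨ws', by omega, h2, h3⟩
  intro N
  induction N with
  | zero =>
    intro ws v hN _ _ _
    have : ws = [] := List.length_eq_zero_iff.1 (by omega)
    subst this
    exact ⟨[], by simp, by simp [secsWord_nil_tuple], by simp⟩
  | succ N ih =>
    intro ws v hN hv hn hws
    match ws with
    | [] => exact ⟨[], by simp, by simp [secsWord_nil_tuple], by simp⟩
    | [u] => exact ⟨[A.secsWord u v], by simp, by simp,
        by simpa using hA.oneLoop_secsWord (hws u (by simp)) v⟩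
    | u₁ :: u₂ :: ws =>
      simp only [List.flatten_cons, List.length_append, List.length_cons] at hn hN
      obtain ⟨ws', h1, h2, h3⟩ := ih ws (A.outsWord (u₁ ++ u₂) v) (by omega)
        (by rw [length_outsWord, hv]) (by omega) fun u hu => hws u (by simp [hu])
      refine ⟨A.secsWord (u₁ ++ u₂) v :: ws', by simp; omega, ?_, ?_⟩
      · rw [List.flatten_cons, List.flatten_cons, ← List.append_assoc, secsWord_append,
          List.flatten_cons, h2]
      · intro u hu
        rcases List.mem_cons.1 hu with rfl | hu
        · exact hA.oneLoop_append (hws _ (by simp)) (hws _ (by simp))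
            (by rw [List.length_append]; omega) hL hv
        · exact h3 u hu

/-- If the loop block survived, the block before it would have written a constant letter `L + 1`
times and the block after it would have read a constant letter `L` times. Both would be stationary,
and the last letter would not move the tuple. -/
theorem low_of_moving {w : List S} (h : A.OneLoop deg d w) {n L : ℕ} (hn : w.length ≤ n)
    (hL : ∀ w v, w.length ≤ n → Low deg d w → A.Moving w v → v.length ≤ L)
    {v : List X} (hv : v.length = L + 1) (hmov : A.Moving w v) :
    Low deg d (A.secsWord w v) := by
  obtain ⟨b, u, b', rfl, hb, hu, hb'⟩ := h
  have easy : Low deg d (A.secsWord u (A.outsWord b v)) →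
      Low deg d (A.secsWord (b ++ (u ++ b')) v) := by
    intro h
    rw [secsWord_append, secsWord_append]
    exact (hA.low_secsWord hb _).append (h.append (hA.low_secsWord hb' _))
  rcases hu with hu | hu
  · exact easy (hA.low_secsWord hu _)
  rcases hA.loopTuple_secsWord hu (A.outsWord b v) with h | ⟨-, -, l, c, hvl, hl, hlow, hc, ho⟩
  · exact easy h
  exfalso
  obtain ⟨v', x, rfl⟩ : ∃ v' x, v = v' ++ [x] := by
    rcases List.eq_nil_or_concat v with rfl | ⟨v', x, h⟩
    · simp at hv
    · exact ⟨v', x, by simpa using h⟩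
  have hv' : v'.length = L := by simpa using hv
  rw [Moving.append_iff] at hmov
  refine hmov.2.1 ?_
  have hlen : (b ++ (u ++ b')).length ≤ n := hn
  simp only [List.length_append] at hlen
  have hu' : ∀ i, A.secsWord u (List.replicate i l) = u := by
    intro i
    induction i with
    | zero => rfl
    | succ i ih => rw [List.replicate_succ, secsWord_cons, hl, ih]
  have hu'' : ∀ i, A.outsWord u (List.replicate i l) = List.replicate i c := by
    intro i
    induction i with
    | zero => rfl
    | succ i ih => rw [List.replicate_succ, outsWord, hl, ih, hc, List.replicate_succ]
  have hbout : A.outsWord b v' = List.replicate L l ∧ A.outs (A.secsWord b v') x = l := by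
    rw [length_outsWord, outsWord_append_word, hv, List.replicate_succ'] at hvl
    have := List.append_inj' hvl rfl
    exact ⟨this.1, by simpa [outsWord] using this.2⟩
  have hbs : A.secs (A.secsWord b v') x = A.secsWord b v' := by
    refine secs_eq_of_outsWord_eq_replicate (L := L) (c := l)
      (fun v => hL b v (by omega) hb) (by omega) ?_
    rw [hvl, length_outsWord, hv, hv']
  have hbs' := secs_secsWord_replicate (L := L) (fun v => hL b' v (by omega) hb') c
  rw [secsWord_append, secsWord_append, hbout.1, hu', hu'', secs_append, secs_append, hbs,
    hbout.2, hl, hc, hbs']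

/-- Loops are guaranteed only after one step, so the first letter of a moving path is spent to get
there. -/
theorem oneLoop_next {g : S} (hg : deg g ≤ d + 1) (x : X) :
    A.OneLoop deg d [A.next g x] := by
  by_cases h : deg (A.next g x) ≤ d
  · exact Low.oneLoop (by simpa [Low] using h)
  · have h1 := hA.next_le g x
    obtain ⟨l, hl, hlow⟩ := hA.exists_loop g x (by omega) (by omega)
    refine ⟨[], [A.next g x], [], by simp, Low.nil, Or.inr ⟨l, by simp [secs, hl], ?_⟩, Low.nil⟩
    intro y hy
    have := hlow y hy
    simp only [secs, Low, List.mem_singleton, forall_eq]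
    omega

theorem loopCountLE_secs {w : List S} (h : Low deg (d + 1) w) (x : X) :
    A.LoopCountLE deg d w.length (A.secs w x) := by
  induction w generalizing x with
  | nil => exact ⟨[], by simp, by simp [secs], by simp⟩
  | cons g w ih =>
    obtain ⟨ws, h1, h2, h3⟩ := ih (fun g hg => h g (by simp [hg])) (A.out g x)
    refine ⟨[A.next g x] :: ws, by simpa using h1, by simp [secs, h2], ?_⟩
    intro u hu
    rcases List.mem_cons.1 hu with rfl | hu
    · exact hA.oneLoop_next (h g (by simp)) x
    · exact h3 u hu

/-- The number of steps of a moving path before a tuple with few loop blocks has lost degree. -/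
theorem length_le_of_loopCountLE {n L : ℕ}
    (hL : ∀ w v, w.length ≤ n → Low deg d w → A.Moving w v → v.length ≤ L) (r : ℕ) :
    ∀ (w : List S) (v : List X), w.length ≤ n → A.LoopCountLE deg d (2 ^ r) w → A.Moving w v →
      v.length ≤ (r + 1) * (L + 1) + L := by
  -- `r` rounds of `L + 1` steps reduce to one loop block, one more round makes it lose degree, and
  -- at most `L` steps remain for a tuple of lower degree.
  induction r with
  | zero =>
    rintro w v hn ⟨ws, h1, rfl, h3⟩ hm
    have hone : A.OneLoop deg d ws.flatten := by
      match ws, h1 with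
      | [], _ => exact Low.nil.oneLoop
      | [u], _ => simpa using h3 u (by simp)
    by_contra! hlt
    rw [← List.take_append_drop (L + 1) v, Moving.append_iff] at hm
    have hlen : (v.take (L + 1)).length = L + 1 := by rw [List.length_take]; omega
    have := hL _ _ (by rwa [length_secsWord]) (hA.low_of_moving hone hn hL hlen hm.1) hm.2
    rw [List.length_drop] at this
    omega
  | succ r ih =>
    intro w v hn hc hm
    by_contra! hlt
    have hpos : L + 1 < v.length := lt_of_le_of_lt (by nlinarith) hlt
    rw [← List.take_append_drop (L + 1) v, Moving.append_iff] at hm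
    have hlen : (v.take (L + 1)).length = L + 1 := by rw [List.length_take]; omega
    have h1 := hA.loopCountLE_secsWord hL hlen _ w hn hc
    have e : (2 ^ (r + 1) + 1) / 2 = 2 ^ r := by rw [pow_succ]; omega
    rw [e] at h1
    have := ih _ _ (by rwa [length_secsWord]) h1 hm.2
    rw [List.length_drop] at this
    have e2 : (r + 1 + 1) * (L + 1) = (r + 1) * (L + 1) + (L + 1) := by ring
    omega

/-- A moving path of a tuple of length at most `n` and degree at most `d` has polylogarithmic
length. -/
theorem length_lt_of_moving (n : ℕ) (d : ℕ) :
    ∀ (w : List S) (v : List X), w.length ≤ n → Low deg d w → A.Moving w v →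
      v.length + 1 ≤ 2 * (Nat.clog 2 n + 3) ^ d := by
  induction d with
  | zero =>
    intro w v _ hw hm
    match v with
    | [] => simp
    | [x] => simp
    -- In degree `0` every state is stationary after one letter, so a second letter cannot move the
    -- tuple.
    | x :: y :: v =>
      exfalso
      refine hm.2.1 ?_
      clear hm
      have : ∀ z, A.secs (A.secs w x) z = A.secs w x := by
        clear y v
        induction w generalizing x with
        | nil => intro z; rfl
        | cons g w ih =>
          intro z
          simp only [secs]
          rw [hA.next_next g x z (Nat.le_zero.1 (hw g (by simp))),
            ih (by simp at *; omega) (fun g hg => hw g (by simp [hg]))]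
      exact this y
  | succ d ih =>
    intro w v hn hw hm
    obtain ⟨L, hLe⟩ : ∃ L, 2 * (Nat.clog 2 n + 3) ^ d = L + 1 :=
      ⟨2 * (Nat.clog 2 n + 3) ^ d - 1, by
        have : 0 < (Nat.clog 2 n + 3) ^ d := by positivity
        omega⟩
    have hL : ∀ w v, w.length ≤ n → Low deg d w → A.Moving w v → v.length ≤ L := by
      intro w v h1 h2 h3
      have := ih w v h1 h2 h3
      omega
    rw [pow_succ, ← mul_assoc, hLe]
    match v with
    | [] => exact Nat.succ_le_of_lt (by simp)
    | x :: v =>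
      obtain ⟨ws, h1, h2, h3⟩ := hA.loopCountLE_secs hw x
      have hc : A.LoopCountLE deg d (2 ^ Nat.clog 2 n) (A.secs w x) :=
        ⟨ws, (h1.trans hn).trans (Nat.le_pow_clog (by norm_num) n), h2, h3⟩
      -- With `r = Nat.clog 2 n` the total plus one is `(r + 2) * (L + 1) + 1`, which is at most `(r
      -- + 3) * (L + 1)`.
      have := hA.length_le_of_loopCountLE hL _ _ v (by rwa [length_secs]) hc hm.2
      rw [List.length_cons]
      nlinarith

end IsLoopDegree

end Depth

end MealyAutomaton

/-! ### Cycles and degrees in polynomial automata -/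

namespace MealyAutomaton

section Cycles

variable {X S : Type*} (A : MealyAutomaton X S)

/-- There is a directed path from `s` to `t`. -/
def Reachable (s t : S) : Prop := ∃ v, A.restr s v = t

/-- The nontrivial state `s` lies on a cycle. -/
def Recurrent (s : S) : Prop := A.act s ≠ id ∧ ∃ x, A.Reachable (A.next s x) s

/-- The largest number of nontrivial cycles on a path that starts at `s`. -/
noncomputable def cycleDegree (s : S) : ℕ := ⨆ v, (A.cyclesAlong s v).ncard

open Classical in
/-- The degree of a state, with value zero at the trivial state. -/
noncomputable def degree (s : S) : ℕ := if A.act s = id then 0 else A.cycleDegree s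

variable {A}

@[simp] theorem restr_nil (s : S) : A.restr s [] = s := rfl

@[simp] theorem restr_cons (s : S) (x : X) (v : List X) :
    A.restr s (x :: v) = A.restr (A.next s x) v := rfl

theorem restr_append (s : S) (v₁ v₂ : List X) :
    A.restr s (v₁ ++ v₂) = A.restr (A.restr s v₁) v₂ :=
  List.foldl_append

theorem Reachable.refl (s : S) : A.Reachable s s := ⟨[], rfl⟩

theorem Reachable.trans {s t u : S} (h₁ : A.Reachable s t) (h₂ : A.Reachable t u) :
    A.Reachable s u := by
  obtain ⟨v₁, rfl⟩ := h₁
  obtain ⟨v₂, rfl⟩ := h₂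
  exact ⟨v₁ ++ v₂, restr_append _ _ _⟩

theorem reachable_restr (s : S) (v : List X) : A.Reachable s (A.restr s v) := ⟨v, rfl⟩

theorem Reachable.next (s : S) (x : X) : A.Reachable s (A.next s x) := ⟨[x], rfl⟩

theorem act_add (s : S) (w : ℕ → X) (m i : ℕ) :
    A.act s w (m + i) = A.act (A.restr s ((List.range m).map w)) (fun j => w (m + j)) i := by
  simp [act, List.range_add, restr_append, Function.comp_def]

theorem act_zero (s : S) (w : ℕ → X) : A.act s w 0 = A.out s (w 0) := rfl

theorem act_succ (s : S) (w : ℕ → X) (i : ℕ) :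
    A.act s w (i + 1) = A.act (A.next s (w 0)) (fun j => w (j + 1)) i := by
  have := act_add (A := A) s w 1 i
  simpa [add_comm] using this

theorem next_eq_of_act_eq_id (hmin : A.IsMinimized) {s : S} (h : A.act s = id) (x : X) :
    A.next s x = s := by
  refine hmin (h ▸ funext fun w => funext fun i => ?_)
  have := act_succ (A := A) s (fun j => j.casesOn x w) i
  rw [h] at this
  exact this.symm

theorem restr_eq_of_act_eq_id (hmin : A.IsMinimized) {s : S} (h : A.act s = id) (v : List X) :
    A.restr s v = s := by
  induction v with
  | nil => rfl
  | cons x v ih => rw [restr_cons, next_eq_of_act_eq_id hmin h, ih]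

theorem act_ne_id_of_reachable (hmin : A.IsMinimized) {s t : S} (h : A.Reachable s t)
    (ht : A.act t ≠ id) : A.act s ≠ id := by
  obtain ⟨v, rfl⟩ := h
  intro hs
  rw [restr_eq_of_act_eq_id hmin hs] at ht
  exact ht hs

theorem mem_path {s : S} {v : List X} {a : S × X} (h : a ∈ A.path s v) :
    ∃ v₁ v₂, v = v₁ ++ a.2 :: v₂ ∧ A.restr s v₁ = a.1 := by
  induction v generalizing s with
  | nil => simp [path] at h
  | cons x v ih =>
    rcases List.mem_cons.1 h with rfl | h
    · exact ⟨[], v, rfl, rfl⟩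
    · obtain ⟨v₁, v₂, h1, h2⟩ := ih h
      exact ⟨x :: v₁, v₂, by simp [h1], h2⟩

theorem length_path (s : S) (v : List X) : (A.path s v).length = v.length := by
  induction v generalizing s with
  | nil => rfl
  | cons x v ih => simp [path, ih]

/-- A shortest path between two states visits no state twice. -/
theorem Reachable.exists_nodup {s t : S} (h : A.Reachable s t) :
    ∃ v, A.restr s v = t ∧ ((A.path s v).map Prod.fst ++ [t]).Nodup := by
  suffices H : ∀ (n : ℕ) (s : S) (v : List X), v.length ≤ n → A.restr s v = t →
      ∃ v', A.restr s v' = t ∧ ((A.path s v').map Prod.fst ++ [t]).Nodup ∧ ∀ a ∈ A.path s v',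
        a.1 ≠ t from by
    obtain ⟨v, hv⟩ := h
    obtain ⟨v', h1, h2, -⟩ := H _ s v le_rfl hv
    exact ⟨v', h1, h2⟩
  intro n
  induction n with
  | zero =>
    intro s v hn hv
    have : v = [] := List.length_eq_zero_iff.1 (by omega)
    subst this
    exact ⟨[], hv, by simp [path], by simp [path]⟩
  | succ n ih =>
    intro s v hn hv
    match v with
    | [] => exact ⟨[], hv, by simp [path], by simp [path]⟩
    | x :: v =>
      obtain ⟨v', h1, h2, h3⟩ := ih (A.next s x) v (by simpa using hn) hv
      by_cases hst : s = t
      · exact ⟨[], hst, by simp [path], by simp [path]⟩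
      by_cases hs : s ∈ (A.path (A.next s x) v').map Prod.fst
      · obtain ⟨⟨s', y⟩, ha, rfl⟩ := List.mem_map.1 hs
        -- If the start occurs again on the path, the path is replaced by its suffix from that
        -- occurrence.
        have hsplit : ∀ (v : List X) (r : S), (s', y) ∈ A.path r v → ∃ v₂, A.restr s' v₂ =
            A.restr r v ∧ (A.path s' v₂).map Prod.fst <:+ (A.path r v).map Prod.fst ∧
            ∀ a ∈ A.path s' v₂, a ∈ A.path r v := by
          intro v
          induction v with
          | nil => intro r h; simp [path] at h
          | cons z v ihv =>
            intro r h
            rcases List.mem_cons.1 h with h | h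
            · cases h
              exact ⟨y :: v, rfl, List.suffix_rfl, fun a ha => ha⟩
            · obtain ⟨v₂, e1, e2, e3⟩ := ihv _ h
              exact ⟨v₂, e1, e2.trans (List.suffix_cons _ _), fun a ha => List.mem_cons_of_mem _ (e3 a ha)⟩
        obtain ⟨v₂, e1, e2, e3⟩ := hsplit _ _ ha
        refine ⟨v₂, e1.trans h1, h2.sublist ?_, fun a ha => h3 a (e3 a ha)⟩
        exact e2.sublist.append_right _
      · refine ⟨x :: v', h1, ?_, ?_⟩
        · simp only [path, List.map_cons, List.cons_append, List.nodup_cons]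
          refine ⟨?_, h2⟩
          simp only [List.mem_append, List.mem_singleton, not_or]
          exact ⟨hs, hst⟩
        · intro a ha
          rcases List.mem_cons.1 ha with rfl | ha
          exacts [hst, h3 a ha]

/-- An arrow from `s` that lies on a closed path lies on a simple cycle through `s`. -/
theorem exists_simple_closed {s : S} {x : X} (h : A.Reachable (A.next s x) s) :
    ∃ v, A.restr s (x :: v) = s ∧ ((A.path s (x :: v)).map Prod.fst).Nodup := by
  obtain ⟨v, h1, h2⟩ := h.exists_nodup
  refine ⟨v, h1, ?_⟩
  -- Moving the end point `s` to the front turns the simple path back to `s` into a simple cycle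
  -- based at `s`.
  rw [List.nodup_append_comm] at h2
  exact h2

theorem isNontrivialCycle_path {s : S} {x : X} {v : List X} (hs : A.act s ≠ id)
    (h : A.restr s (x :: v) = s) (hv : ((A.path s (x :: v)).map Prod.fst).Nodup) :
    A.IsNontrivialCycle {a | a ∈ A.path s (x :: v)} := by
  refine ⟨⟨s, x :: v, by simp, h, hv, rfl⟩, ?_⟩
  rintro ⟨e, y, he, -, hC⟩
  have : (s, x) ∈ ({(e, y)} : Set (S × X)) := by
    rw [← hC]
    simp [path]
  obtain ⟨rfl, -⟩ := Prod.mk.inj (Set.mem_singleton_iff.1 this)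
  exact hs (funext he)

theorem Recurrent.exists_cycle {s : S} (h : A.Recurrent s) :
    ∃ C, A.IsNontrivialCycle C ∧ s ∈ Prod.fst '' C := by
  obtain ⟨hs, x, hx⟩ := h
  obtain ⟨v, h1, h2⟩ := exists_simple_closed hx
  exact ⟨_, isNontrivialCycle_path hs h1 h2, (s, x), by simp [path], rfl⟩

theorem IsCycle.reachable {C : Set (S × X)} (hC : A.IsCycle C) {s t : S}
    (hs : s ∈ Prod.fst '' C) (ht : t ∈ Prod.fst '' C) : A.Reachable s t := by
  obtain ⟨r, v, -, hr, -, rfl⟩ := hC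
  obtain ⟨a, ha, rfl⟩ := hs
  obtain ⟨b, hb, rfl⟩ := ht
  obtain ⟨v₁, v₂, e, h⟩ := mem_path ha
  obtain ⟨v₃, v₄, -, h'⟩ := mem_path hb
  refine Reachable.trans (t := r) ⟨a.2 :: v₂, ?_⟩ ⟨v₃, h'⟩
  rw [← h, ← restr_append, ← e, hr]

/-- In a polynomial automaton a recurrent state has only one arrow on a closed path. -/
theorem IsPolynomial.eq_of_reachable (hpol : A.IsPolynomial) {s : S} (hs : A.act s ≠ id) {x y : X}
    (hx : A.Reachable (A.next s x) s) (hy : A.Reachable (A.next s y) s) : x = y := by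
  obtain ⟨v, h1, h2⟩ := exists_simple_closed hx
  obtain ⟨v', h1', h2'⟩ := exists_simple_closed hy
  have hC := isNontrivialCycle_path hs h1 h2
  have hC' := isNontrivialCycle_path hs h1' h2'
  have hCC : {a | a ∈ A.path s (x :: v)} = {a | a ∈ A.path s (y :: v')} := by
    by_contra hne
    refine Set.disjoint_left.1 (hpol _ _ hC hC' hne) (show s ∈ _ from ?_) ?_
    · exact ⟨(s, x), by simp [path], rfl⟩
    · exact ⟨(s, y), by simp [path], rfl⟩
  have hmem : (s, x) ∈ A.path s (y :: v') := by
    have : (s, x) ∈ {a | a ∈ A.path s (x :: v)} := by simp [path]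
    rwa [hCC] at this
  have := List.inj_on_of_nodup_map h2' hmem (by simp [path] : (s, y) ∈ A.path s (y :: v')) rfl
  exact congrArg Prod.snd this

/-- At each state only one letter allows a return. The induction moves the base point along the
closed path, where this stays true. -/
theorem IsPolynomial.word_eq_of_reachable (hpol : A.IsPolynomial) (hmin : A.IsMinimized) {s : S}
    (hs : A.act s ≠ id) {v v' : List X} (hlen : v.length = v'.length)
    (hv : A.Reachable (A.restr s v) s) (hv' : A.Reachable (A.restr s v') s) : v = v' := by
  induction v generalizing s v' with
  | nil => exact (List.length_eq_zero_iff.1 hlen.symm).symm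
  | cons x v ih =>
    match v' with
    | y :: v' =>
      have hx : A.Reachable (A.next s x) s := (reachable_restr _ v).trans hv
      have hy : A.Reachable (A.next s y) s := (reachable_restr _ v').trans hv'
      obtain rfl := hpol.eq_of_reachable hs hx hy
      rw [ih (s := A.next s x) (act_ne_id_of_reachable hmin hx hs) (by simpa using hlen)
        (hv.trans (Reachable.next _ _)) (hv'.trans (Reachable.next _ _))]

theorem cyclesAlong_subset (s : S) (u v : List X) :
    A.cyclesAlong (A.restr s u) v ⊆ A.cyclesAlong s (u ++ v) := by
  rintro C ⟨hC, u', hu', hmem⟩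
  exact ⟨hC, u ++ u', List.prefix_append_right_inj u |>.2 hu', by rwa [restr_append]⟩

theorem restr_flatten_replicate {s : S} {v : List X} (h : A.restr s v = s) (k : ℕ) :
    A.restr s (List.replicate k v).flatten = s := by
  induction k with
  | zero => rfl
  | succ k ih => rw [List.replicate_succ, List.flatten_cons, restr_append, h, ih]

section FiniteStates

variable [Finite S]

/-- A long path meets the trivial state or a recurrent one. -/
theorem exists_recurrent_of_length {s : S} {v : List X} (hv : Nat.card S ≤ v.length) :
    ∃ t, A.Reachable s t ∧ A.Reachable t (A.restr s v) ∧ (A.act t = id ∨ A.Recurrent t) := by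
  have := Fintype.ofFinite S
  have hninj : ¬ Function.Injective fun i : Fin (v.length + 1) => A.restr s (v.take i) := by
    intro hinj
    have := Fintype.card_le_of_injective _ hinj
    rw [Fintype.card_fin, ← Nat.card_eq_fintype_card] at this
    omega
  have hlt : ∃ i j : ℕ, i < j ∧ j ≤ v.length ∧ A.restr s (v.take i) = A.restr s (v.take j) := by
    simp only [Function.Injective, not_forall] at hninj
    obtain ⟨i, j, hij, hne⟩ := hninj
    rcases lt_or_gt_of_ne (fun h => hne (Fin.ext h) : (i : ℕ) ≠ j) with h | h
    · exact ⟨i, j, h, by omega, hij⟩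
    · exact ⟨j, i, h, by omega, hij.symm⟩
  obtain ⟨i, j, hij, hj, he⟩ := hlt
  refine ⟨A.restr s (v.take i), reachable_restr _ _, ⟨v.drop i, ?_⟩, ?_⟩
  · rw [← restr_append, List.take_append_drop]
  · by_cases h : A.act (A.restr s (v.take i)) = id
    · exact Or.inl h
    · refine Or.inr ⟨h, ?_⟩
      have hd : v.take j = v.take i ++ (v.drop i).take (j - i) := by
        rw [← List.take_add]; congr 1; omega
      rw [hd, restr_append] at he
      match hw : (v.drop i).take (j - i) with
      | [] =>
        have := congrArg List.length hw
        rw [List.length_take, List.length_drop, List.length_nil] at this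
        omega
      | x :: w =>
        rw [hw] at he
        exact ⟨x, w, he.symm⟩

/-- At a recurrent state there is a closed path of each length that is divisible by the lengths of
all simple cycles. -/
theorem Recurrent.exists_closed {s : S} (hs : A.Recurrent s) {l : ℕ}
    (hl : ∀ c, 0 < c → c ≤ Nat.card S → c ∣ l) : ∃ v, v.length = l ∧ A.restr s v = s := by
  have := Fintype.ofFinite S
  obtain ⟨-, x, hx⟩ := hs
  obtain ⟨v, h1, h2⟩ := exists_simple_closed hx
  have hc : (x :: v).length ≤ Nat.card S := by
    have := h2.length_le_card
    rwa [List.length_map, length_path, ← Nat.card_eq_fintype_card] at this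
  obtain ⟨k, hk⟩ := hl _ (by simp) hc
  exact ⟨(List.replicate k (x :: v)).flatten, by simp [hk, mul_comm],
    restr_flatten_replicate h1 k⟩

end FiniteStates

section Degree

variable {m : ℤ}

theorem DegreeLE.bddAbove (hdeg : A.DegreeLE m) (s : S) :
    BddAbove (Set.range fun v => (A.cyclesAlong s v).ncard) := by
  refine ⟨(m + 1).toNat, ?_⟩
  rintro _ ⟨v, rfl⟩
  have := hdeg s v
  dsimp only
  omega

theorem DegreeLE.degree_le (hdeg : A.DegreeLE m) (s : S) : A.degree s ≤ (m + 1).toNat := by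
  unfold degree
  split_ifs
  · simp
  · refine ciSup_le fun v => ?_
    have := hdeg s v
    omega

theorem DegreeLE.ncard_le (hdeg : A.DegreeLE m) (s : S) (v : List X) :
    (A.cyclesAlong s v).ncard ≤ A.cycleDegree s :=
  le_ciSup (hdeg.bddAbove s) v

variable [Finite S] [Finite X]

theorem cyclesAlong_finite (s : S) (v : List X) : (A.cyclesAlong s v).Finite := Set.toFinite _

theorem DegreeLE.cycleDegree_le (hdeg : A.DegreeLE m) {s t : S} (h : A.Reachable s t) :
    A.cycleDegree t ≤ A.cycleDegree s := by
  obtain ⟨u, rfl⟩ := h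
  refine ciSup_le fun v => ?_
  exact (Set.ncard_le_ncard (cyclesAlong_subset s u v) (cyclesAlong_finite _ _)).trans
    (hdeg.ncard_le s _)

theorem DegreeLE.degree_le_of_reachable (hdeg : A.DegreeLE m) (hmin : A.IsMinimized) {s t : S}
    (h : A.Reachable s t) : A.degree t ≤ A.degree s := by
  by_cases ht : A.act t = id
  · simp [degree, ht]
  · simpa [degree, ht, act_ne_id_of_reachable hmin h ht] using hdeg.cycleDegree_le h

/-- Take a cycle through `s` and a path from `t` that meets the most cycles. If it missed that
cycle, prefixing the path from `s` to `t` would give one cycle more. So it meets the cycle and can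
return to `s`. -/
theorem DegreeLE.reachable_of_cycleDegree_le (hdeg : A.DegreeLE m) {s t : S}
    (hs : A.Recurrent s) (h : A.Reachable s t) (hst : A.cycleDegree s ≤ A.cycleDegree t) :
    A.Reachable t s := by
  obtain ⟨C, hC, hsC⟩ := hs.exists_cycle
  obtain ⟨u, rfl⟩ := h
  obtain ⟨v, hv⟩ := Nat.sSup_mem (Set.range_nonempty _) (hdeg.bddAbove (A.restr s u))
  have hv : (A.cyclesAlong (A.restr s u) v).ncard = A.cycleDegree (A.restr s u) := hv
  have hmem : C ∈ A.cyclesAlong (A.restr s u) v := by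
    by_contra hnot
    have h1 : insert C (A.cyclesAlong (A.restr s u) v) ⊆ A.cyclesAlong s (u ++ v) :=
      Set.insert_subset ⟨hC, [], List.nil_prefix, hsC⟩ (cyclesAlong_subset s u v)
    have h2 := Set.ncard_le_ncard h1 (cyclesAlong_finite _ _)
    rw [Set.ncard_insert_of_notMem hnot (cyclesAlong_finite _ _)] at h2
    have := hdeg.ncard_le s (u ++ v)
    omega
  obtain ⟨-, u', -, hu'⟩ := hmem
  exact (reachable_restr _ u').trans (hC.1.reachable hu' hsC)

theorem Recurrent.cycleDegree_pos (hdeg : A.DegreeLE m) {s : S} (hs : A.Recurrent s) :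
    0 < A.cycleDegree s := by
  obtain ⟨C, hC, hsC⟩ := hs.exists_cycle
  refine lt_of_lt_of_le ?_ (hdeg.ncard_le s [])
  rw [Set.ncard_pos (cyclesAlong_finite _ _)]
  exact ⟨C, hC, [], List.nil_prefix, hsC⟩

/-- A path of this length meets a trivial or a recurrent state, and a recurrent one would have
positive degree. -/
theorem restr_restr_of_degree_eq_zero (hmin : A.IsMinimized) (hdeg : A.DegreeLE m) {s : S}
    {v : List X} (hv : Nat.card S ≤ v.length) (h : A.degree s = 0) (u : List X) :
    A.restr (A.restr s v) u = A.restr s v := by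
  obtain ⟨t, ⟨v₁, hst⟩, ⟨v₂, hte⟩, ht⟩ := exists_recurrent_of_length (A := A) (s := s) hv
  suffices ht : A.act t = id by
    rw [← hte, restr_eq_of_act_eq_id hmin ht, restr_eq_of_act_eq_id hmin ht]
  refine ht.resolve_right fun ht => ?_
  have h1 := ht.cycleDegree_pos hdeg
  have h2 := hdeg.degree_le_of_reachable hmin ⟨v₁, hst⟩
  rw [h, degree, if_neg ht.1] at h2
  omega

/-- The long path passes a recurrent state `t`. As the degree has not dropped, its end `e` can
return to `t`, hence is itself recurrent and has a closed path of length `l`. Any other word of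
length `l` that keeps the degree could also be continued back to `e`, against uniqueness. -/
theorem exists_loop_of_degree_eq (hmin : A.IsMinimized) (hpol : A.IsPolynomial)
    (hdeg : A.DegreeLE m) {s : S} {v : List X} {l : ℕ} (hv : Nat.card S ≤ v.length)
    (hl : ∀ c, 0 < c → c ≤ Nat.card S → c ∣ l)
    (h : A.degree (A.restr s v) = A.degree s) (hpos : 0 < A.degree s) :
    ∃ u, u.length = l ∧ A.restr (A.restr s v) u = A.restr s v ∧
      ∀ u', u'.length = l → u' ≠ u → A.degree (A.restr (A.restr s v) u') < A.degree s := by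
  obtain ⟨t, hst, hte, ht⟩ := exists_recurrent_of_length (A := A) (s := s) hv
  set e := A.restr s v with he
  have hne : ∀ {r : S}, 0 < A.degree r → A.act r ≠ id := by
    intro r hr h
    simp [degree, h] at hr
  have hce : ∀ {r : S}, A.act r ≠ id → A.degree r = A.cycleDegree r := fun hr => if_neg hr
  have hee : A.act e ≠ id := hne (by omega)
  have htt : A.act t ≠ id := act_ne_id_of_reachable hmin hte hee
  have htrec := ht.resolve_left htt
  have hd1 := hdeg.degree_le_of_reachable hmin hst
  have hd2 := hdeg.degree_le_of_reachable hmin hte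
  have het : A.Reachable e t := by
    refine hdeg.reachable_of_cycleDegree_le htrec hte ?_
    rw [← hce htt, ← hce hee]
    omega
  have herec : A.Recurrent e := by
    refine ⟨hee, ?_⟩
    obtain ⟨w, hw⟩ := het
    match w with
    | [] =>
      obtain ⟨-, x, hx⟩ := htrec
      rw [restr_nil] at hw
      subst hw
      exact ⟨x, hx⟩
    | x :: w => exact ⟨x, Reachable.trans ⟨w, hw⟩ hte⟩
  obtain ⟨u, hu, hue⟩ := herec.exists_closed hl
  refine ⟨u, hu, hue, fun u' hu' hne' => ?_⟩
  by_contra! hge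
  refine hne' (hpol.word_eq_of_reachable hmin hee (by omega) ?_ ?_)
  · have hn : A.act (A.restr e u') ≠ id := hne (by omega)
    refine hdeg.reachable_of_cycleDegree_le herec (reachable_restr _ _) ?_
    rw [← hce hn, ← hce hee]
    omega
  · rw [hue]; exact Reachable.refl _

end Degree

end Cycles

end MealyAutomaton

/-! ### Disjoint unions and power alphabets -/

namespace MealyAutomaton

section Constructions

variable {X S Y : Type*} (A : MealyAutomaton X S)

/-- The disjoint union of automata. -/
def sigma {ι : Type*} {S : ι → Type*} (A : ∀ i, MealyAutomaton X (S i)) :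
    MealyAutomaton X (Σ i, S i) where
  next s x := ⟨s.1, (A s.1).next s.2 x⟩
  out s := (A s.1).out s.2

theorem restr_sigma {ι : Type*} {S : ι → Type*} (A : ∀ i, MealyAutomaton X (S i)) (i : ι)
    (s : S i) (v : List X) : (sigma A).restr ⟨i, s⟩ v = ⟨i, (A i).restr s v⟩ := by
  induction v generalizing s with
  | nil => rfl
  | cons x v ih => exact ih _

theorem act_sigma {ι : Type*} {S : ι → Type*} (A : ∀ i, MealyAutomaton X (S i)) (i : ι)
    (s : S i) : (sigma A).act ⟨i, s⟩ = (A i).act s := by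
  funext w n
  rw [act, restr_sigma]
  rfl

/-- The output of a state at words of a fixed length. -/
def outFn (s : S) {l : ℕ} (y : Fin l → X) : Fin l → X :=
  fun i => A.out (A.restr s ((List.ofFn y).take i)) (y i)

/-- Equal prefixes lead to the same state, whose output is a permutation. This makes the power
automaton invertible. -/
theorem outFn_injective (s : S) {l : ℕ} : Function.Injective (A.outFn s (l := l)) := by
  intro y y' h
  have key : ∀ (n : ℕ) (hn : n < l), y ⟨n, hn⟩ = y' ⟨n, hn⟩ := by
    intro n
    induction n using Nat.strong_induction_on with
    | _ n ih =>
      intro hn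
      have htake : (List.ofFn y).take n = (List.ofFn y').take n := by
        refine List.ext_getElem (by simp) fun i h1 h2 => ?_
        have hi : i < n := by simp at h1; omega
        simpa using ih i hi (hi.trans hn)
      have := congrFun h ⟨n, hn⟩
      simp only [outFn, htake] at this
      exact (A.out _).injective this
  exact funext fun i => key i i.2

variable {l : ℕ} (e : Y ≃ (Fin l → X))

/-- The automaton over an alphabet whose letters stand for the words of length `l`. -/
noncomputable def power [Finite X] : MealyAutomaton Y S where
  next s y := A.restr s (List.ofFn (e y))
  out s := (e.trans (Equiv.ofBijective _ (Finite.injective_iff_bijective.1 (A.outFn_injective s)))).trans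
    e.symm

/-- The infinite word over `X` that is encoded by an infinite word over the power alphabet. -/
def flat [NeZero l] (u : ℕ → Y) : ℕ → X :=
  fun n => e (u (n / l)) ⟨n % l, Nat.mod_lt _ (NeZero.pos l)⟩

section Flat

variable [NeZero l]

theorem flat_of_lt (u : ℕ → Y) {n : ℕ} (hn : n < l) : flat e u n = e (u 0) ⟨n, hn⟩ := by
  simp [flat, Nat.div_eq_of_lt hn, Nat.mod_eq_of_lt hn]

theorem flat_add (u : ℕ → Y) (n : ℕ) : flat e u (l + n) = flat e (fun j => u (j + 1)) n := by
  simp [flat, Nat.add_div_left n (NeZero.pos l)]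

theorem flat_injective : Function.Injective (flat e) := by
  intro u u' h
  funext n
  refine e.injective (funext fun i => ?_)
  have := congrFun h (l * n + i)
  simpa [flat, Nat.mul_add_div (NeZero.pos l), Nat.div_eq_of_lt i.2, Nat.mod_eq_of_lt i.2]
    using this

theorem flat_surjective : Function.Surjective (flat e) := by
  intro w
  refine ⟨fun n => e.symm fun i => w (l * n + i), funext fun n => ?_⟩
  simp [flat, Nat.div_add_mod]

theorem map_range_flat (u : ℕ → Y) {n : ℕ} (hn : n ≤ l) :
    (List.range n).map (flat e u) = (List.ofFn (e (u 0))).take n := by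
  refine List.ext_getElem (by simp [hn]) fun i h1 h2 => ?_
  have hi : i < n := by simpa using h1
  simp [flat_of_lt e u (hi.trans_le hn)]

theorem act_flat [Finite X] (s : S) (u : ℕ → Y) :
    A.act s (flat e u) = flat e ((A.power e).act s u) := by
  funext n
  induction n using Nat.strong_induction_on generalizing s u with
  | _ n ih =>
    by_cases hn : n < l
    · rw [flat_of_lt e _ hn, act, map_range_flat e u hn.le, flat_of_lt e u hn, act_zero]
      simp [power, outFn]
    · obtain ⟨i, rfl⟩ := Nat.exists_eq_add_of_le (not_lt.1 hn)
      have hl := NeZero.pos l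
      rw [act_add, map_range_flat e u le_rfl, List.take_of_length_le (by simp)]
      simp only [flat_add, act_succ]
      exact ih i (by omega) _ _

theorem tupleAct_flat [Finite X] (w : List S) (u : ℕ → Y) :
    A.tupleAct w (flat e u) = flat e ((A.power e).tupleAct w u) := by
  induction w generalizing u with
  | nil => rfl
  | cons g w ih =>
    rw [tupleAct, List.foldl_cons, act_flat]
    exact ih _

theorem tupleAct_power_eq_self_iff [Finite X] (w : List S) :
    (∀ u, (A.power e).tupleAct w u = u) ↔ ∀ u, A.tupleAct w u = u := by
  constructor
  · intro h u
    obtain ⟨u, rfl⟩ := flat_surjective e u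
    rw [tupleAct_flat, h]
  · intro h u
    apply flat_injective e
    rw [← tupleAct_flat, h]

end Flat

section TupleAct

variable {A}

theorem tupleAct_zero (w : List S) (u : ℕ → X) : A.tupleAct w u 0 = A.outs w (u 0) := by
  induction w generalizing u with
  | nil => rfl
  | cons g w ih =>
    rw [tupleAct, List.foldl_cons]
    exact ih _

theorem tupleAct_succ (w : List S) (u : ℕ → X) (n : ℕ) :
    A.tupleAct w u (n + 1) = A.tupleAct (A.secs w (u 0)) (fun j => u (j + 1)) n := by
  induction w generalizing u with
  | nil => rfl
  | cons g w ih =>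
    rw [tupleAct, List.foldl_cons]
    refine (ih _).trans ?_
    rw [act_zero, secs, tupleAct, tupleAct, List.foldl_cons]
    simp only [act_succ]

/-- A tuple acts trivially if it fixes all letters and the sections that differ from it act
trivially. -/
theorem tupleAct_eq_self_iff (w : List S) :
    (∀ u, A.tupleAct w u = u) ↔ (∀ x, A.outs w x = x) ∧
      ∀ x, A.secs w x ≠ w → ∀ u, A.tupleAct (A.secs w x) u = u := by
  constructor
  · refine fun h => ⟨fun x => ?_, fun x _ u => funext fun n => ?_⟩
    · rw [← tupleAct_zero w fun _ => x, h]
    · have := congrFun (h fun j => j.casesOn x u) (n + 1)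
      rwa [tupleAct_succ] at this
  · rintro ⟨h1, h2⟩ u
    funext n
    induction n generalizing u with
    | zero => rw [tupleAct_zero, h1]
    | succ n ih =>
      rw [tupleAct_succ]
      by_cases hx : A.secs w (u 0) = w
      · rw [hx, ih]
      · rw [h2 _ hx]

end TupleAct

/-- The disjoint union need not be minimized, so degrees are taken in the components. The length `l`
has to exceed the pigeonhole bound and to be a multiple of all cycle lengths. -/
theorem isLoopDegree_power_sigma [Finite X] {ι : Type*} {S : ι → Type*} [∀ i, Finite (S i)]
    {A : ∀ i, MealyAutomaton X (S i)} {m : ℤ} (hmin : ∀ i, (A i).IsMinimized)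
    (hpol : ∀ i, (A i).IsPolynomial) (hdeg : ∀ i, (A i).DegreeLE m)
    (hcard : ∀ i, Nat.card (S i) ≤ l) (hdvd : ∀ i, ∀ c, 0 < c → c ≤ Nat.card (S i) → c ∣ l) :
    ((sigma A).power e).IsLoopDegree fun s => (A s.1).degree s.2 := by
  have hnext : ∀ (i : ι) (s : S i) (y : Y), ((sigma A).power e).next ⟨i, s⟩ y =
      ⟨i, (A i).restr s (List.ofFn (e y))⟩ := fun i s y => restr_sigma A i s _
  constructor
  · rintro ⟨i, s⟩ y
    rw [hnext]
    exact (hdeg i).degree_le_of_reachable (hmin i) (reachable_restr _ _)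
  · rintro ⟨i, s⟩ y z h
    rw [hnext i s y, hnext i _ z, restr_restr_of_degree_eq_zero (hmin i) (hdeg i) (s := s)
      (by simpa using hcard i) h]
  · rintro ⟨i, s⟩ y h hpos
    rw [hnext i s y] at h ⊢
    obtain ⟨u, hu, h1, h2⟩ := exists_loop_of_degree_eq (hmin i) (hpol i) (hdeg i) (s := s)
      (by simpa using hcard i) (hdvd i) h hpos
    obtain ⟨f, rfl⟩ : ∃ f : Fin l → X, u = List.ofFn f := by
      subst hu
      exact ⟨u.get, (List.ofFn_get u).symm⟩
    refine ⟨e.symm f, by rw [hnext, e.apply_symm_apply, h1], fun z hz => ?_⟩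
    rw [hnext i _ z]
    refine h2 _ (by simp) fun h => hz ?_
    rw [← e.symm_apply_apply z, List.ofFn_injective h]

/-- A product of permutations applies its last factor first, a tuple its first state; hence the
reversal. -/
theorem tupleAct_reverse_map {ι : Type*} {g : ι → Equiv.Perm (ℕ → X)} {st : ι → S}
    (h : ∀ i, A.act (st i) = g i) (w : List ι) :
    A.tupleAct (w.map st).reverse = (w.map g).prod := by
  induction w with
  | nil => rfl
  | cons i w ih =>
    funext u
    have := congrFun ih u
    simp only [tupleAct] at this
    simp [tupleAct, this, h]

end Constructions

/-- Finitely many elements of `Pol X m` are states of one automaton with finitely many states in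
which all nontrivial cycles are loops, over an alphabet that encodes the words of some length. -/
theorem exists_isLoopDegree {X : Type*} [Finite X] [Nonempty X] {m : ℤ} {ι : Type} [Finite ι]
    {g : ι → Equiv.Perm (ℕ → X)} (hg : ∀ i, g i ∈ Pol X m) :
    ∃ (q : ℕ) (S : Type) (_ : Finite S) (B : MealyAutomaton (Fin (q + 1)) S) (deg : S → ℕ)
      (st : ι → S), B.IsLoopDegree deg ∧ (∀ s, deg s ≤ (m + 1).toNat) ∧
      ∀ w : List ι, (w.map g).prod = 1 ↔ ∀ u, B.tupleAct (w.map st).reverse u = u := by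
  choose S hS A s hmin hpol hdeg hact using hg
  have := Fintype.ofFinite ι
  have := Fintype.ofFinite X
  set N := ∑ i, Nat.card (S i) with hN
  have hle : ∀ i, Nat.card (S i) ≤ N := fun i =>
    Finset.single_le_sum (f := fun i => Nat.card (S i)) (fun _ _ => Nat.zero_le _)
      (Finset.mem_univ i)
  -- The word length `N!` is at least every `Nat.card (S i)` and divisible by every possible cycle
  -- length.
  have : NeZero N.factorial := ⟨N.factorial_ne_zero⟩
  obtain ⟨q, hq⟩ := Nat.exists_eq_succ_of_ne_zero
    (Fintype.card_ne_zero (α := Fin N.factorial → X))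
  let e : Fin (q + 1) ≃ (Fin N.factorial → X) := (Fintype.equivFinOfCardEq hq).symm
  refine ⟨q, Σ i, S i, inferInstance, (sigma A).power e, fun s => (A s.1).degree s.2,
    fun i => ⟨i, s i⟩, isLoopDegree_power_sigma e hmin hpol hdeg ?_ ?_, ?_, ?_⟩
  · exact fun i => (hle i).trans (Nat.self_le_factorial N)
  · exact fun i c h0 h1 => Nat.dvd_factorial h0 (h1.trans (hle i))
  · exact fun s => (hdeg s.1).degree_le s.2
  · intro w
    rw [tupleAct_power_eq_self_iff, tupleAct_reverse_map (sigma A) (g := g)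
      (fun i => (act_sigma A i (s i)).trans (hact i)), Equiv.ext_iff]
    rfl

end MealyAutomaton

/-! ### A stack machine for the search through the sections -/

namespace TupleMachine

open Turing StateTransition

/-- The stacks of the machine that decides whether a tuple of states acts trivially. -/
inductive Stack (q : ℕ)
  | input
  | output
  | work
  | child (y : Fin (q + 1))
  deriving DecidableEq, Fintype

/-- The alphabets of the stacks; on the stack of pending tuples, `none` ends a tuple. -/
abbrev Symbol (q : ℕ) (I S : Type) : Stack q → Type
  | .input => I
  | .output => Bool
  | .work => Option S
  | .child _ => Option S

/-- The labels of the machine. -/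
inductive Label (q : ℕ)
  | start
  | load
  | read
  | mark (y : Fin (q + 1))
  | move (y : Fin (q + 1))
  deriving Fintype

/-- The internal memory: for each letter its image under the part of the tuple that has been read,
and whether the section at it differs from that part; whether a tuple has been found that moves a
letter; and the last symbol read. -/
structure Memory (q : ℕ) (S : Type) where
  cur : Fin (q + 1) → Fin (q + 1)
  moved : Fin (q + 1) → Bool
  bad : Bool
  buf : Option (Option S)

noncomputable instance (q : ℕ) (S : Type) [Finite S] : Fintype (Memory q S) :=
  have := Fintype.ofFinite S
  Fintype.ofInjective (fun v : Memory q S => (v.cur, v.moved, v.bad, v.buf)) fun v v' h => by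
    cases v
    cases v'
    simpa using h

/-- The memory at the beginning of a tuple. -/
def fresh (q : ℕ) (S : Type) (bad : Bool) : Memory q S := ⟨id, fun _ => false, bad, none⟩

variable {q : ℕ} {I S : Type} (B : MealyAutomaton (Fin (q + 1)) S) (st : I → S)

/-- The symbol pushed on the stack of the letter `y` when a state is read. -/
def sym (v : Memory q S) (y : Fin (q + 1)) : Option S :=
  (v.buf.getD none).map fun g => B.next g (v.cur y)

/-- Push the sections of the state that was read on the stacks of the letters. -/
def pushChildren (ys : List (Fin (q + 1)))
    (rest : TM2.Stmt (Symbol q I S) (Label q) (Memory q S)) :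
    TM2.Stmt (Symbol q I S) (Label q) (Memory q S) :=
  ys.foldr (fun y t => .push (.child y) (fun v => sym B v y) t) rest

open Classical in
/-- Update the memory after a state has been read. -/
noncomputable def absorb (v : Memory q S) : Memory q S where
  cur y := match v.buf with
    | some (some g) => B.out g (v.cur y)
    | _ => v.cur y
  moved y := match v.buf with
    | some (some g) => v.moved y || decide (B.next g (v.cur y) ≠ g)
    | _ => v.moved y
  bad := v.bad
  buf := none

/-- What follows after the stack of the letter `y` has been treated. -/
def advance (y : Fin (q + 1)) : TM2.Stmt (Symbol q I S) (Label q) (Memory q S) :=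
  if h : y.val + 1 < q + 1 then .goto fun _ => .mark ⟨y + 1, h⟩
  else .load (fun v => fresh q S v.bad) (.goto fun _ => .read)

/-- The program: load the input, then depth-first search through the sections of the tuple. -/
noncomputable def program : Label q → TM2.Stmt (Symbol q I S) (Label q) (Memory q S)
  | .start => .push .work (fun _ => none) (.goto fun _ => .load)
  | .load => .pop .input (fun v (a : Option I) => { v with buf := a.map fun i => some (st i) })
      (.branch (fun v => v.buf.isSome)
        (.push .work (fun v => v.buf.getD none)
          (.load (fun v => { v with buf := none }) (.goto fun _ => .load)))
        (.goto fun _ => .read))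
  | .read => .pop .work (fun v (a : Option (Option S)) => { v with buf := a })
      (.branch (fun v => v.buf.isSome)
        (.branch (fun v => (v.buf.getD none).isSome)
          (pushChildren B (List.finRange (q + 1)) (.load (absorb B) (.goto fun _ => .read)))
          (.load (fun v => { v with bad := v.bad || decide (v.cur ≠ id), buf := none })
            (.goto fun _ => .mark 0)))
        (.push .output (fun v => !v.bad) (.load (fun _ => fresh q S false) .halt)))
  | .mark y => .branch (fun v => v.moved y) (.push .work (fun _ => none) (.goto fun _ => .move y))
      (.goto fun _ => .move y)
  | .move y => .pop (.child y) (fun v (a : Option (Option S)) => { v with buf := a })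
      (.branch (fun v => v.buf.isSome)
        (.branch (fun v => v.moved y)
          (.push .work (fun v => v.buf.getD none)
            (.load (fun v => { v with buf := none }) (.goto fun _ => .move y)))
          (.load (fun v => { v with buf := none }) (.goto fun _ => .move y)))
        (advance y))

/-- The contents of the stacks. -/
def contents (inp : List I) (out : List Bool) (W : List (Option S))
    (ch : Fin (q + 1) → List (Option S)) : ∀ k : Stack q, List (Symbol q I S k)
  | .input => inp
  | .output => out
  | .work => W
  | .child y => ch y

section Update

variable (inp : List I) (out : List Bool) (W : List (Option S)) (ch : Fin (q + 1) → List (Option S))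

theorem update_input (x : List I) :
    Function.update (contents inp out W ch) .input x = contents x out W ch := by
  funext k; cases k <;> simp [contents]

theorem update_output (x : List Bool) :
    Function.update (contents inp out W ch) .output x = contents inp x W ch := by
  funext k; cases k <;> simp [contents]

theorem update_work (x : List (Option S)) :
    Function.update (contents inp out W ch) .work x = contents inp out x ch := by
  funext k; cases k <;> simp [contents]

theorem update_child (y : Fin (q + 1)) (x : List (Option S)) :
    Function.update (contents inp out W ch) (.child y) x =
      contents inp out W (Function.update ch y x) := by
  funext k
  cases k with
  | child z =>
    by_cases h : z = y
    · subst h; simp [contents]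
    · simp [contents, h]
  | _ => simp [contents]

end Update

/-- The configurations of the machine. -/
def cfg (l : Label q) (v : Memory q S) (inp : List I) (W : List (Option S))
    (ch : Fin (q + 1) → List (Option S)) : TM2.Cfg (Symbol q I S) (Label q) (Memory q S) :=
  ⟨some l, v, contents inp [] W ch⟩

theorem stepAux_pushChildren (ys : List (Fin (q + 1))) (hys : ys.Nodup)
    (rest : TM2.Stmt (Symbol q I S) (Label q) (Memory q S)) (v : Memory q S) (inp : List I)
    (out : List Bool) (W : List (Option S)) (ch : Fin (q + 1) → List (Option S)) :
    TM2.stepAux (pushChildren B ys rest) v (contents inp out W ch) =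
      TM2.stepAux rest v
        (contents inp out W fun y => if y ∈ ys then sym B v y :: ch y else ch y) := by
  induction ys generalizing ch with
  | nil => simp [pushChildren]
  | cons y ys ih =>
    rw [List.nodup_cons] at hys
    change TM2.stepAux (pushChildren B ys rest) v
      (Function.update (contents inp out W ch) (.child y) (sym B v y :: ch y)) = _
    rw [update_child, ih hys.2]
    congr 2
    funext z
    by_cases hz : z = y
    · subst hz; simp [hys.1]
    · simp [hz]

/-- The machine gets from one configuration to another in at most `n` steps. -/
def Within (n : ℕ) (a b : TM2.Cfg (Symbol q I S) (Label q) (Memory q S)) : Prop :=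
  Nonempty (EvalsToInTime (TM2.step (program B st)) a (some b) n)

section Run

variable {B st}

theorem Within.refl (a : TM2.Cfg (Symbol q I S) (Label q) (Memory q S)) : Within B st 0 a a :=
  ⟨EvalsToInTime.refl _ _⟩

theorem Within.trans {m n : ℕ} {a b c : TM2.Cfg (Symbol q I S) (Label q) (Memory q S)}
    (h₁ : Within B st m a b) (h₂ : Within B st n b c) : Within B st (m + n) a c := by
  obtain ⟨h₁⟩ := h₁
  obtain ⟨h₂⟩ := h₂
  rw [add_comm]
  exact ⟨h₁.trans _ _ _ _ _ _ h₂⟩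

theorem Within.mono {m n : ℕ} {a b : TM2.Cfg (Symbol q I S) (Label q) (Memory q S)}
    (h : Within B st m a b) (hmn : m ≤ n) : Within B st n a b := by
  obtain ⟨h⟩ := h
  exact ⟨⟨h.1, h.2.trans hmn⟩⟩

theorem Within.single {a b : TM2.Cfg (Symbol q I S) (Label q) (Memory q S)}
    (h : TM2.step (program B st) a = some b) : Within B st 1 a b :=
  ⟨⟨⟨1, h⟩, le_rfl⟩⟩

theorem within_start (v : Memory q S) (inp : List I) (W : List (Option S))
    (ch : Fin (q + 1) → List (Option S)) :
    Within B st 1 (cfg .start v inp W ch) (cfg .load v inp (none :: W) ch) := by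
  refine .single ?_
  simp only [cfg, TM2.step, program, TM2.stepAux, update_work]
  rfl

theorem within_load (b : Bool) (inp : List I) (W : List (Option S))
    (ch : Fin (q + 1) → List (Option S)) :
    Within B st (inp.length + 1) (cfg .load (fresh q S b) inp W ch)
      (cfg .read (fresh q S b) [] ((inp.map st).reverse.map some ++ W) ch) := by
  induction inp generalizing W with
  | nil =>
    refine .single ?_
    simp only [cfg, TM2.step, program, TM2.stepAux, update_input]
    rfl
  | cons i inp ih =>
    have h1 : Within B st 1 (cfg .load (fresh q S b) (i :: inp) W ch)
        (cfg .load (fresh q S b) inp (some (st i) :: W) ch) := by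
      refine .single ?_
      simp only [cfg, TM2.step, program, TM2.stepAux, update_input, update_work]
      rfl
    have h := (h1.trans (ih _)).mono (n := (i :: inp).length + 1) (by simp; omega)
    simpa using h

theorem within_read_some (v : Memory q S) (g : S) (W : List (Option S))
    (ch : Fin (q + 1) → List (Option S)) :
    Within B st 1 (cfg .read v [] (some g :: W) ch)
      (cfg .read (absorb B { v with buf := some (some g) }) [] W
        fun y => some (B.next g (v.cur y)) :: ch y) := by
  refine .single ?_
  simp only [cfg, TM2.step, program, TM2.stepAux, update_work]
  change some (TM2.stepAux (pushChildren B _ _) _ _) = _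
  rw [stepAux_pushChildren B _ (List.nodup_finRange _)]
  simp only [TM2.stepAux, List.mem_finRange, if_true]
  rfl

-- A section equals the tuple iff it does so state by state, so one bit per letter suffices for the
-- comparison. Pushing leaves the sections reversed.
open Classical in
theorem within_read_tuple (w : List S) (v : Memory q S) (hv : v.buf = none) (W : List (Option S))
    (ch : Fin (q + 1) → List (Option S)) :
    Within B st w.length (cfg .read v [] (w.map some ++ W) ch)
      (cfg .read ⟨fun y => B.outs w (v.cur y),
        fun y => v.moved y || decide (B.secs w (v.cur y) ≠ w), v.bad, none⟩ [] W
        fun y => (B.secs w (v.cur y)).reverse.map some ++ ch y) := by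
  induction w generalizing v ch with
  | nil =>
    obtain ⟨cur, moved, bad, buf⟩ := v
    subst hv
    simpa [MealyAutomaton.outs, MealyAutomaton.secs] using Within.refl _
  | cons g w ih =>
    have h := (within_read_some v g (w.map some ++ W) ch).trans (ih
      (absorb B { v with buf := some (some g) }) rfl (fun y => some (B.next g (v.cur y)) :: ch y))
    replace h := h.mono (n := (g :: w).length) (by simp; omega)
    convert h using 2
    · rfl
    · congr 1
      funext y
      by_cases h1 : B.next g (v.cur y) = g <;>
        by_cases h2 : B.secs w (B.out g (v.cur y)) = w <;>
        simp [MealyAutomaton.secs, absorb, h1, h2]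
    · funext y
      simp [MealyAutomaton.secs, absorb]

theorem within_read_none (v : Memory q S) (W : List (Option S))
    (ch : Fin (q + 1) → List (Option S)) :
    Within B st 1 (cfg .read v [] (none :: W) ch)
      (cfg (.mark 0) { v with bad := v.bad || decide (v.cur ≠ id), buf := none } [] W ch) := by
  refine .single ?_
  simp only [cfg, TM2.step, program, TM2.stepAux, update_work]
  rfl

theorem within_mark (v : Memory q S) (y : Fin (q + 1)) (W : List (Option S))
    (ch : Fin (q + 1) → List (Option S)) :
    Within B st 1 (cfg (.mark y) v [] W ch)
      (cfg (.move y) v [] ((if v.moved y then [none] else []) ++ W) ch) := by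
  refine .single ?_
  simp only [cfg, TM2.step, program, TM2.stepAux, update_work]
  cases v.moved y <;> rfl

/-- The configuration after the stack of the letter `y` has been treated. -/
def afterMove (y : Fin (q + 1)) (v : Memory q S) (W : List (Option S))
    (ch : Fin (q + 1) → List (Option S)) : TM2.Cfg (Symbol q I S) (Label q) (Memory q S) :=
  if h : y.val + 1 < q + 1 then cfg (.mark ⟨y + 1, h⟩) v [] W ch
  else cfg .read (fresh q S v.bad) [] W ch

/-- Popping and pushing reverses a second time and so restores the order of a section. A section
equal to the tuple is discarded. -/
theorem within_move (v : Memory q S) (hv : v.buf = none) (y : Fin (q + 1)) (w : List S)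
    (W : List (Option S)) (ch : Fin (q + 1) → List (Option S)) (hw : ch y = w.map some) :
    Within B st (w.length + 1) (cfg (.move y) v [] W ch)
      (afterMove y v ((if v.moved y then w.reverse.map some else []) ++ W)
        (Function.update ch y [])) := by
  obtain ⟨cur, moved, bad, buf⟩ := v
  obtain rfl : buf = none := hv
  induction w generalizing W ch with
  | nil =>
    refine .single ?_
    simp only [cfg, TM2.step, program, TM2.stepAux, update_child]
    simp only [contents, hw, advance, afterMove, List.map_nil, List.head?_nil, List.tail_nil]
    split_ifs <;> rfl
  | cons g w ih =>
    have h1 : Within B st 1 (cfg (.move y) ⟨cur, moved, bad, none⟩ [] W ch)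
        (cfg (.move y) ⟨cur, moved, bad, none⟩ [] ((if moved y then [some g] else []) ++ W)
          (Function.update ch y (w.map some))) := by
      refine .single ?_
      simp only [cfg, TM2.step, program, TM2.stepAux, update_child]
      simp only [contents, hw, List.map_cons, List.head?_cons, List.tail_cons]
      cases moved y
      · rfl
      · simp only [update_work]
        rfl
    have h2 := h1.trans (ih ((if moved y then [some g] else []) ++ W)
      (Function.update ch y (w.map some)) (by simp))
    replace h2 := h2.mono (n := (g :: w).length + 1) (by simp; omega)
    convert h2 using 2
    · by_cases h : moved y = true <;> simp [h]
    · simp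

/-- The contents of the work stack for a list of pending tuples. -/
def pending (ws : List (List S)) : List (Option S) :=
  ws.flatMap fun w => w.map some ++ [none]

/-- Induction on the number `r` of letters after `y`; the stacks of the letters before `y` are
already empty. -/
theorem within_distribute (w : List S) (v : Memory q S) (hv : v.buf = none)
    (hmoved : ∀ y, v.moved y = true ↔ B.secs w y ≠ w) (r : ℕ) :
    ∀ (y : Fin (q + 1)) (W : List (Option S)) (ch : Fin (q + 1) → List (Option S)), y + r = q →
      (∀ z, ch z = if y ≤ z then (B.secs w z).reverse.map some else []) →
      ∃ ws : List (List S), ws.length ≤ r + 1 ∧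
        (∀ u, u ∈ ws ↔ ∃ z, y ≤ z ∧ B.secs w z ≠ w ∧ B.secs w z = u) ∧
        Within B st ((r + 1) * (w.length + 2)) (cfg (.mark y) v [] W ch)
          (cfg .read (fresh q S v.bad) [] (pending ws ++ W) fun _ => []) := by
  have one : ∀ (y : Fin (q + 1)) (W : List (Option S)) (ch : Fin (q + 1) → List (Option S)),
      ch y = (B.secs w y).reverse.map some →
      ∃ ws : List (List S), ws.length ≤ 1 ∧ (∀ u, u ∈ ws ↔ B.secs w y ≠ w ∧ B.secs w y = u) ∧
        Within B st (w.length + 2) (cfg (.mark y) v [] W ch)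
          (afterMove y v (pending ws ++ W) (Function.update ch y [])) := by
    intro y W ch hch
    have h := (within_mark (B := B) (st := st) v y W ch).trans
      (within_move (B := B) (st := st) v hv y _ _ ch hch)
    have hlen : 1 + ((B.secs w y).reverse.length + 1) = w.length + 2 := by
      rw [List.length_reverse, MealyAutomaton.length_secs]; omega
    rw [hlen] at h
    have hm := hmoved y
    cases hvy : v.moved y
    · refine ⟨[], by simp, fun u => ?_, ?_⟩
      · rw [hvy] at hm
        simp at hm
        simp [hm]
      · simpa [hvy, pending] using h
    · refine ⟨[B.secs w y], by simp, fun u => ?_, ?_⟩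
      · rw [hvy] at hm
        simp at hm
        simp [hm, eq_comm]
      · simpa [hvy, pending] using h
  induction r with
  | zero =>
    intro y W ch hy hch
    obtain ⟨ws, h1, h2, h3⟩ := one y W ch (by simpa using hch y)
    refine ⟨ws, h1, fun u => ?_, ?_⟩
    · rw [h2]
      constructor
      · exact fun h => ⟨y, le_rfl, h⟩
      · rintro ⟨z, hz, h⟩
        obtain rfl : y = z := by ext; have := z.2; rw [Fin.le_def] at hz; omega
        exact h
    · rw [afterMove, dif_neg (by omega)] at h3
      rw [zero_add, one_mul]
      convert h3 using 2
      funext z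
      by_cases hz : z = y
      · simp [hz]
      · have : ¬ y ≤ z := fun h => hz (by ext; have := z.2; rw [Fin.le_def] at h; omega)
        simp [hz, hch, this]
  | succ r ih =>
    intro y W ch hy hch
    obtain ⟨ws, h1, h2, h3⟩ := one y W ch (by simpa using hch y)
    have hlt : y.val + 1 < q + 1 := by omega
    rw [afterMove, dif_pos hlt] at h3
    obtain ⟨ws', h1', h2', h3'⟩ := ih ⟨y + 1, hlt⟩ (pending ws ++ W) (Function.update ch y [])
      (by simp; omega) (by
        intro z
        by_cases hz : z = y
        · subst hz
          simp [Fin.le_def]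
        · have hne : z.val ≠ y.val := fun h => hz (Fin.ext h)
          rw [Function.update_of_ne hz, hch]
          congr 1
          simp only [Fin.le_def, eq_iff_iff]
          omega)
    refine ⟨ws' ++ ws, by simp; omega, fun u => ?_, ?_⟩
    · rw [List.mem_append, h2, h2']
      constructor
      · rintro (⟨z, hz, h⟩ | h)
        · exact ⟨z, by rw [Fin.le_def] at hz ⊢; simp at hz; omega, h⟩
        · exact ⟨y, le_rfl, h⟩
      · rintro ⟨z, hz, h⟩
        by_cases hzy : z = y
        · subst hzy; exact Or.inr h
        · refine Or.inl ⟨z, ?_, h⟩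
          have hne : z.val ≠ y.val := fun h => hzy (Fin.ext h)
          rw [Fin.le_def] at hz ⊢
          simp
          omega
    · have := (h3.trans h3').mono (n := (r + 1 + 1) * (w.length + 2)) (by ring_nf; omega)
      simpa [pending] using this

/-- One round of the search replaces a tuple by the sections that differ from it. -/
theorem within_round (w : List S) (b : Bool) (W : List (Option S)) :
    ∃ ws : List (List S), ws.length ≤ q + 1 ∧
      (∀ u, u ∈ ws ↔ ∃ z, B.secs w z ≠ w ∧ B.secs w z = u) ∧
      Within B st ((q + 2) * (w.length + 2))
        (cfg .read (fresh q S b) [] (pending [w] ++ W) fun _ => [])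
        (cfg .read (fresh q S (b || decide (B.outs w ≠ id))) [] (pending ws ++ W)
          fun _ => []) := by
  classical
  have h1 := within_read_tuple (B := B) (st := st) w (fresh q S b) rfl (none :: W) fun _ => []
  have h2 := h1.trans (within_read_none _ _ _)
  obtain ⟨ws, h3, h4, h5⟩ := within_distribute (B := B) (st := st) w
    ⟨B.outs w, fun y => decide (B.secs w y ≠ w), b || decide (B.outs w ≠ id), none⟩ rfl (by simp)
    q 0 W (fun y => (B.secs w y).reverse.map some) (by simp) (by simp)
  refine ⟨ws, h3, by simpa using h4, ?_⟩
  refine Within.mono (m := w.length + 1 + (q + 1) * (w.length + 2)) ?_ (by ring_nf; omega)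
  refine Within.trans ?_ h5
  convert h2 using 1
  · simp [pending]
  · simp [fresh, funext_iff]
    congr 2
    funext y
    by_cases h : B.secs w y = w <;> simp [h]

open Classical in
/-- The search through the sections of a tuple. -/
theorem within_search (L : ℕ) : ∀ (w : List S) (b : Bool) (W : List (Option S)),
    (∀ v, B.Moving w v → v.length ≤ L) →
    Within B st ((q + 2) * (w.length + 2) * (q + 2) ^ L)
      (cfg .read (fresh q S b) [] (pending [w] ++ W) fun _ => [])
      (cfg .read (fresh q S (b || decide (¬ ∀ u, B.tupleAct w u = u))) [] W fun _ => []) := by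
  induction L with
  | zero =>
    intro w b W hL
    obtain ⟨ws, -, h2, h3⟩ := within_round (B := B) (st := st) w b W
    have hst : ∀ z, B.secs w z = w := by
      intro z
      by_contra hz
      simpa using hL [z] ⟨hz, trivial⟩
    have hws : ws = [] := List.eq_nil_iff_forall_not_mem.2 fun u hu => by
      obtain ⟨z, hz, -⟩ := (h2 u).1 hu
      exact hz (hst z)
    subst hws
    have he : (∀ u, B.tupleAct w u = u) ↔ B.outs w = id := by
      rw [MealyAutomaton.tupleAct_eq_self_iff, funext_iff]
      simp [hst]
    simpa [pending, he] using h3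
  | succ L ih =>
    intro w b W hL
    obtain ⟨ws, h1, h2, h3⟩ := within_round (B := B) (st := st) w b W
    have hws : ∀ u ∈ ws, u.length = w.length ∧ ∀ v, B.Moving u v → v.length ≤ L := by
      intro u hu
      obtain ⟨z, hz, rfl⟩ := (h2 u).1 hu
      refine ⟨MealyAutomaton.length_secs _ _, fun v hv => ?_⟩
      simpa using hL (z :: v) ⟨hz, hv⟩
    -- The flag is never reset between pending tuples, so it accumulates the disjunction of the
    -- results.
    have hlist : ∀ (ws : List (List S)) (b : Bool),
        (∀ u ∈ ws, u.length = w.length ∧ ∀ v, B.Moving u v → v.length ≤ L) →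
        Within B st (ws.length * ((q + 2) * (w.length + 2) * (q + 2) ^ L))
          (cfg .read (fresh q S b) [] (pending ws ++ W) fun _ => [])
          (cfg .read (fresh q S (b || decide (∃ u ∈ ws, ¬ ∀ u', B.tupleAct u u' = u'))) [] W
            fun _ => []) := by
      intro ws
      induction ws with
      | nil => intro b _; simpa [pending] using Within.refl _
      | cons u ws ihws =>
        intro b hu
        have h1 := ih u b (pending ws ++ W) (hu u (by simp)).2
        rw [(hu u (by simp)).1] at h1
        have h2 := h1.trans (ihws _ fun u' hu' => hu u' (by simp [hu']))
        replace h2 := h2.mono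
          (n := (u :: ws).length * ((q + 2) * (w.length + 2) * (q + 2) ^ L))
          (by rw [List.length_cons, add_one_mul, add_comm])
        convert h2 using 2
        · simp [pending]
        · congr 1
          rw [Bool.or_assoc, ← Bool.decide_or]
          simp
    have h4 := h3.trans (hlist ws _ hws)
    replace h4 := h4.mono (n := (q + 2) * (w.length + 2) * (q + 2) ^ (L + 1)) ?_
    swap
    -- One round costs `c`, followed by at most `q + 1` searches of depth `L`.
    · have hp : 1 ≤ (q + 2) ^ L := Nat.one_le_pow _ _ (by omega)
      set c := (q + 2) * (w.length + 2)
      calc c + ws.length * (c * (q + 2) ^ L) ≤ c * (q + 2) ^ L + (q + 1) * (c * (q + 2) ^ L) :=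
            Nat.add_le_add (Nat.le_mul_of_pos_right _ hp) (Nat.mul_le_mul_right _ h1)
        _ = c * (q + 2) ^ (L + 1) := by ring
    · convert h4 using 3
      rw [Bool.or_assoc, ← Bool.decide_or]
      congr 2
      rw [eq_iff_iff, MealyAutomaton.tupleAct_eq_self_iff, not_and_or]
      refine or_congr ?_ ?_
      · rw [ne_eq, funext_iff]; rfl
      · push Not
        constructor
        · rintro ⟨x, hx, h⟩
          exact ⟨_, (h2 _).2 ⟨x, hx, rfl⟩, h⟩
        · rintro ⟨u, hu, h⟩
          obtain ⟨x, hx, rfl⟩ := (h2 u).1 hu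
          exact ⟨x, hx, h⟩

end Run

/-- The machine with its finiteness data. -/
noncomputable def machine [Fintype I] [Finite S] : FinTM2 where
  K := Stack q
  k₀ := .input
  k₁ := .output
  Γ := Symbol q I S
  Λ := Label q
  main := .start
  σ := Memory q S
  initialState := fresh q S false
  Γk₀Fin := inferInstanceAs (Fintype I)
  m := program B st

-- Loading the input on the work stack produces the reversed tuple. The summand `n + 3` counts the
-- start, the loading of `n` letters with its final test, and the halting step.
open Classical in
theorem machine_outputs [Fintype I] [Finite S] {L : ℕ} (inp : List I)
    (hL : ∀ v, B.Moving (inp.map st).reverse v → v.length ≤ L) :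
    Nonempty (TM2OutputsInTime (machine B st) inp
      (some [decide (∀ u, B.tupleAct (inp.map st).reverse u = u)])
      (inp.length + 3 + (q + 2) * (inp.length + 2) * (q + 2) ^ L)) := by
  have h1 := (within_start (B := B) (st := st) (fresh q S false) inp [] fun _ => []).trans
    (within_load _ _ _ _)
  have h2 := within_search (B := B) (st := st) L (inp.map st).reverse false [] hL
  have h3 : Within B st _ (cfg .start (fresh q S false) inp [] fun _ => []) _ :=
    h1.trans (by
      simpa only [pending, List.flatMap_cons, List.flatMap_nil, List.append_nil, List.append_assoc,
        Bool.false_or] using h2)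
  have h4 : TM2.step (program B st) (cfg .read (fresh q S
      (decide (¬ ∀ u, B.tupleAct (inp.map st).reverse u = u))) [] [] fun _ => []) =
      some ⟨none, fresh q S false, contents []
        [decide (∀ u, B.tupleAct (inp.map st).reverse u = u)] [] fun _ => []⟩ := by
    simp only [cfg, TM2.step, program, TM2.stepAux, update_work]
    change some (TM2.Cfg.mk none _ (Function.update _ _ _)) = _
    rw [update_output]
    by_cases h : ∀ u, B.tupleAct (inp.map st).reverse u = u <;> simp [h, fresh, contents]
  have h5 := (h3.trans (.single h4)).mono (n := inp.length + 3 +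
    (q + 2) * (inp.length + 2) * (q + 2) ^ L) (by
      simp only [List.length_reverse, List.length_map]; omega)
  have e1 : (initList (machine B st) inp : TM2.Cfg (Symbol q I S) (Label q) (Memory q S)) =
      cfg .start (fresh q S false) inp [] fun _ => [] := by
    change TM2.Cfg.mk _ _ _ = TM2.Cfg.mk _ _ _
    congr 1
    funext k
    cases k <;> rfl
  have e2 : (haltList (machine B st) [decide (∀ u, B.tupleAct (inp.map st).reverse u = u)] :
      TM2.Cfg (Symbol q I S) (Label q) (Memory q S)) = ⟨none, fresh q S false, contents []
        [decide (∀ u, B.tupleAct (inp.map st).reverse u = u)] [] fun _ => []⟩ := by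
    change TM2.Cfg.mk _ _ _ = TM2.Cfg.mk _ _ _
    congr 1
    funext k
    cases k <;> rfl
  obtain ⟨h⟩ := h5
  exact ⟨⟨⟨h.steps, (congrArg (fun c => (flip bind (TM2.step (program B st)))^[h.steps] (some c))
    e1).trans (h.evals_in_steps.trans (congrArg some e2.symm))⟩, h.steps_le_m⟩⟩

end TupleMachine

/-! ### Estimates of the running time -/

namespace TupleMachine

open Turing

/-- The running time of the machine for tuples of degree at most `d`. -/
def runningTime (q d n : ℕ) : ℕ :=
  n + 3 + (q + 2) * (n + 2) * (q + 2) ^ (2 * (Nat.clog 2 n + 3) ^ d)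

/-- The polynomial factors are absorbed by `n ≤ 2 ^ Nat.clog 2 n`. This needs an exponent `e ≥ 1`,
whereas `d` may be `0`. -/
theorem runningTime_le (q d e n : ℕ) (hde : d ≤ e) (he : 1 ≤ e) :
    runningTime q d n ≤ (q + 2) ^ (4 * (Nat.clog 2 n + 3) ^ e) := by
  unfold runningTime
  set N := 2 ^ Nat.clog 2 n with hN
  set t := Nat.clog 2 n + 3 with ht
  set P := 2 * t ^ d with hP
  have h1 : n ≤ N := Nat.le_pow_clog (by norm_num) n
  have h2 : 1 ≤ N := Nat.one_le_two_pow
  have h3 : 4 * N ≤ (q + 2) ^ (Nat.clog 2 n + 2) := by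
    calc 4 * N = 2 ^ (Nat.clog 2 n + 2) := by rw [hN, pow_add]; ring
      _ ≤ _ := Nat.pow_le_pow_left (by omega) _
  have h4 : 1 ≤ (q + 2) ^ P := Nat.one_le_pow _ _ (by omega)
  have h5 : t + 1 + P ≤ 4 * t ^ e := by
    have a1 : t ^ d ≤ t ^ e := Nat.pow_le_pow_right (by omega) hde
    have a2 : t ≤ t ^ e := Nat.le_self_pow (by omega) t
    omega
  calc n + 3 + (q + 2) * (n + 2) * (q + 2) ^ P
      ≤ (q + 2) ^ (Nat.clog 2 n + 2) + (q + 2) * (q + 2) ^ (Nat.clog 2 n + 2) * (q + 2) ^ P := by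
        gcongr <;> omega
    _ ≤ (q + 2) * (q + 2) ^ (Nat.clog 2 n + 2) * (q + 2) ^ P +
        (q + 2) * (q + 2) ^ (Nat.clog 2 n + 2) * (q + 2) ^ P := by
        gcongr
        rw [mul_assoc, mul_left_comm]
        exact Nat.le_mul_of_pos_right _ (by positivity)
    _ = 2 * (q + 2) ^ (t + P) := by rw [ht]; ring
    _ ≤ (q + 2) * (q + 2) ^ (t + P) := Nat.mul_le_mul_right _ (by omega)
    _ = (q + 2) ^ (t + 1 + P) := by ring
    _ ≤ _ := Nat.pow_le_pow_right (by omega) h5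

/-- The exponent in the bound for the running time. -/
noncomputable def timeConstant (q e : ℕ) : ℝ :=
  Real.log (q + 2) * (4 * (5 / Real.log 2) ^ e)

theorem timeConstant_pos (q e : ℕ) : 0 < timeConstant q e := by
  have h1 : 0 < Real.log (q + 2) := Real.log_pos (by
    have : (0 : ℝ) ≤ q := Nat.cast_nonneg q
    linarith)
  have h2 : 0 < Real.log 2 := Real.log_pos (by norm_num)
  unfold timeConstant
  positivity

theorem runningTime_le_exp (q d e n : ℕ) (hde : d ≤ e) (he : 1 ≤ e) (hn : 2 ≤ n) :
    (runningTime q d n : ℝ) ≤ Real.exp (timeConstant q e * Real.log n ^ e) := by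
  have hlog2 : 0 < Real.log 2 := Real.log_pos (by norm_num)
  have hlogq : 0 ≤ Real.log (q + 2) := Real.log_nonneg (by
    have : (0 : ℝ) ≤ q := Nat.cast_nonneg q
    linarith)
  -- Rounding up costs `1`, which with the `3` gives `4`; this is at most `4 * Real.logb 2 n`
  -- because `n ≥ 2`.
  have ht : ((Nat.clog 2 n + 3 : ℕ) : ℝ) ≤ 5 / Real.log 2 * Real.log n := by
    have h1 : (Nat.clog 2 n : ℝ) ≤ Real.logb 2 n + 1 := by
      have := Real.natCeil_logb_natCast 2 n
      rw [← this]
      refine (Nat.ceil_lt_add_one (Real.logb_nonneg (by norm_num) ?_)).le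
      exact_mod_cast (by omega : 1 ≤ n)
    have h2 : 1 ≤ Real.logb 2 n := by
      rw [Real.le_logb_iff_rpow_le (by norm_num) (by positivity)]
      simpa using (by exact_mod_cast hn : (2 : ℝ) ≤ n)
    have h3 : 5 / Real.log 2 * Real.log n = 5 * Real.logb 2 n := by
      rw [Real.logb]; ring
    rw [h3]
    push_cast
    linarith
  calc (runningTime q d n : ℝ) ≤ ((q + 2 : ℕ) : ℝ) ^ (4 * (Nat.clog 2 n + 3) ^ e) := by
        exact_mod_cast runningTime_le q d e n hde he
    _ = Real.exp (Real.log (q + 2) * (4 * ((Nat.clog 2 n + 3 : ℕ) : ℝ) ^ e)) := by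
        rw [Real.exp_mul, Real.exp_log (by positivity)]
        rw [← Real.rpow_natCast]
        push_cast
        rfl
    _ ≤ Real.exp (Real.log (q + 2) * (4 * (5 / Real.log 2 * Real.log n) ^ e)) := by
        gcongr
    _ = _ := by
        unfold timeConstant
        congr 1
        rw [mul_pow]
        ring

/-- Every power of `log n` is `o(n)`. The exponent `d + 1` covers the case `d = 0`. -/
theorem isSubexponential_runningTime (q d : ℕ) : IsSubexponential (runningTime q d) := by
  intro a ha
  have hK := timeConstant_pos q (d + 1)
  set K := timeConstant q (d + 1)
  have hloga := Real.log_pos ha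
  have h := (Real.isLittleO_pow_log_id_atTop (n := d + 1)).bound (div_pos hloga hK)
  filter_upwards [tendsto_natCast_atTop_atTop.eventually h, Filter.eventually_ge_atTop 2]
    with n h1 h2
  refine (runningTime_le_exp q d (d + 1) n (by omega) (by omega) h2).trans ?_
  have h3 : Real.log n ^ (d + 1) ≤ Real.log a / K * n := by
    have := (le_abs_self _).trans h1
    simpa using this
  rw [← Real.exp_log (show 0 < a ^ n by positivity), Real.log_pow]
  refine Real.exp_le_exp.2 ?_
  calc K * Real.log n ^ (d + 1) ≤ K * (Real.log a / K * n) := by gcongr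
    _ = n * Real.log a := by field_simp

theorem runningTime_le_rpow (q d c : ℕ) (hc : 1 < c) (hd : 1 ≤ d) :
    ∃ C : ℝ, 0 < C ∧ ∀ n : ℕ, 2 ≤ n → (runningTime q d n : ℝ) ≤ (c : ℝ) ^ (C * Real.log n ^ d) := by
  have hlogc : 0 < Real.log c := Real.log_pos (by exact_mod_cast hc)
  refine ⟨timeConstant q d / Real.log c, div_pos (timeConstant_pos q d) hlogc, fun n hn => ?_⟩
  refine (runningTime_le_exp q d d n le_rfl hd hn).trans_eq ?_
  rw [Real.rpow_def_of_pos (by exact_mod_cast (by omega : 0 < c))]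
  congr 1
  field_simp

end TupleMachine

theorem corollary1 {X : Type*} [Fintype X] [Nontrivial X] (m : ℤ) (hm : -1 ≤ m)
    (G : Subgroup (Equiv.Perm (ℕ → X))) (hG : (G : Set (Equiv.Perm (ℕ → X))) ⊆ Pol X m)
    (k : ℕ) (s : Fin k → G) (hs : Subgroup.closure (Set.range s) = ⊤) :
    ∃ M : Turing.TM2ComputableInTime (id : List (Fin k × Bool) → List (Fin k × Bool))
        Computability.encodeBool (wordProblem s),
      IsSubexponential M.time ∧
      (0 ≤ m → ∃ C : ℝ, 0 < C ∧ ∀ n : ℕ, 2 ≤ n →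
        (M.time n : ℝ) ≤ (Fintype.card X : ℝ) ^ (C * Real.log n ^ (m + 1))) := by
  classical
  -- Inverses of generators lie in `G`, hence in `Pol X m`, so they are states of polynomial
  -- automata as well and no inverse automaton has to be built.
  let g : Fin k × Bool → G := fun a => if a.2 then s a.1 else (s a.1)⁻¹
  obtain ⟨q, S, _, B, deg, st, hB, hdeg, hact⟩ :=
    MealyAutomaton.exists_isLoopDegree (g := fun a => (g a : Equiv.Perm (ℕ → X)))
      (fun a => hG (g a).2)
  set d := (m + 1).toNat with hd
  have hword : ∀ w, wordProblem s w = decide (∀ u, B.tupleAct (w.map st).reverse u = u) := by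
    intro w
    rw [wordProblem, decide_eq_decide, ← hact, wordValue, ← OneMemClass.coe_eq_one,
      ← Subgroup.coe_subtype, map_list_prod, List.map_map]
    rfl
  have hout : ∀ w : List (Fin k × Bool), Nonempty (Turing.TM2OutputsInTime
      (TupleMachine.machine B st) w (some [wordProblem s w])
      (TupleMachine.runningTime q d w.length)) := by
    intro w
    rw [hword]
    refine TupleMachine.machine_outputs B st w fun v hv => ?_
    have := hB.length_lt_of_moving w.length d _ v (by simp) (fun g _ => hdeg g) hv
    omega
  refine ⟨{
    tm := TupleMachine.machine B st
    inputAlphabet := Equiv.refl _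
    outputAlphabet := Equiv.refl _
    time := TupleMachine.runningTime q d
    outputsFun := fun w => Classical.choice ((congrArg (fun l => Nonempty
      (Turing.TM2OutputsInTime (TupleMachine.machine B st) l (some [wordProblem s w])
        (TupleMachine.runningTime q d w.length))) (List.map_id w)).mpr (hout w)) },
    TupleMachine.isSubexponential_runningTime q d, fun h0 => ?_⟩
  -- Here `0 ≤ m` gives `d ≥ 1`. The change of base from the power alphabet to `X` only affects `C`.
  obtain ⟨C, hC, hCn⟩ := TupleMachine.runningTime_le_rpow q d (Fintype.card X)
    Fintype.one_lt_card (by omega)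
  refine ⟨C, hC, fun n hn => ?_⟩
  have hz : m + 1 = (d : ℤ) := by omega
  rw [hz, zpow_natCast]
  exact hCn n hn
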